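/- Consider the rank-3 $O(N)^3$ tensor model with a single real tensor field and the wheel ($K_{3,3}$) interaction vertex. The vertex has six fields labelled $1,\dots,6$, joined by red edges $16,23,45$, green edges $12,34,56$ and blue edges $14,25,36$. A vacuum diagram consists of finitely many such vertices whose fields are paired into propagators by a Wick contraction, together with finitely many rings (propagators closed into a circle without a vertex). Vertices may be renamed, and the fields of each vertex may be relabelled by a colour-preserving automorphism of the wheel. In the multi-line notation a loop of a given colour alternates between propagators and edges of that colour inside the vertices; a ring carries one loop of each colour. A connected vacuum diagram is called maximal if its total number of loops is the largest possible among all connected vacuum diagrams with the same number of interaction vertices. The elementary snail is the two-point diagram with one vertex in which $3$ is contracted with $6$ and $4$ with $5$, the fields $1$ and $2$ being the external legs. The elementary melon is the two-point diagram with two vertices $L,R$ in which $i_L$ is contracted with $i_R$ for $i=2,\dots,6$, the fields $1_L$ and $1_R$ being the external legs. Colour permutations of these are obtained by applying one and the same field permutation to all vertices, namely one that realises a permutation of the three colours of the wheel. Theorem. A vacuum diagram is connected and maximal if and only if it can be generated from the diagram without interaction vertices (a single ring) by finitely many moves, each of which replaces one propagator (possibly that of the ring) by the elementary melon or by the elementary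 snail, up to colour permutation. -/

import Mathlib

/-!
Vacuum Feynman diagrams of the rank-3 `O(N)³` tensor model with the wheel (`K_{3,3}`) interaction.
Colours are `0 = red`, `1 = green`, `2 = blue`.  The six fields of an interaction vertex, usually
labelled `1, …, 6`, are labelled here by `0, …, 5`.
-/

namespace WheelModel

/-- The labelled interaction graph of the wheel: `wheel c i` is the field joined to the field `i` by
the edge of colour `c`.  With labels `1, …, 6`, the red edges are `16, 23, 45`, the green edges are
`12, 34, 56` and the blue edges are `14, 25, 36`, as in the interaction
`φ^{a₁b₁c₁} φ^{a₂b₁c₂} φ^{a₂b₂c₃} φ^{a₃b₂c₁} φ^{a₃b₃c₂} φ^{a₁b₃c₃}`. -/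
def wheel : Fin 3 → Fin 6 → Fin 6 :=
  ![![5, 2, 1, 4, 3, 0], ![1, 0, 3, 2, 5, 4], ![3, 4, 5, 0, 1, 2]]

/-- A permutation of the six fields which realises some permutation of the three colours of the
wheel. -/
def IsColourPermutation (g : Equiv.Perm (Fin 6)) : Prop :=
  ∃ π : Equiv.Perm (Fin 3), ∀ c i, wheel (π c) (g i) = g (wheel c i)

/-- An automorphism of the wheel: a permutation of the six fields which preserves every colour. -/
def IsAutomorphism (g : Equiv.Perm (Fin 6)) : Prop :=
  ∀ c i, wheel c (g i) = g (wheel c i)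

/-- A (not necessarily connected) vacuum diagram: a finite set `V` of interaction vertices, a Wick
contraction, that is, a perfect matching of the fields `V × Fin 6` of these vertices into
propagators, and a number of rings, that is, of propagators closed up into a circle without any
interaction vertex. -/
structure Diagram where
  /-- the interaction vertices -/
  V : Type
  /-- there are finitely many of them -/
  finite : Finite V
  /-- the Wick contraction -/
  contr : V × Fin 6 → V × Fin 6
  /-- contraction is symmetric -/
  contr_contr : ∀ h, contr (contr h) = h
  /-- no field is contracted with itself -/
  contr_ne : ∀ h, contr h ≠ h
  /-- the number of rings -/
  rings : ℕ

namespace Diagram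

/-- The number of interaction vertices. -/
noncomputable def numVertices (D : Diagram) : ℕ := Nat.card D.V

/-- The number of connected components, each ring being one. -/
noncomputable def numComponents (D : Diagram) : ℕ :=
  D.rings + Nat.card (Quot fun v w : D.V => ∃ i j, D.contr (v, i) = (w, j))

/-- A connected vacuum diagram, i.e. one that contributes to the free energy. -/
def Connected (D : Diagram) : Prop := D.numComponents = 1

/-- The number of loops of colour `c` in the multi-line notation.  A line of colour `c` follows
propagators and, inside each interaction vertex, the edges of colour `c` of the wheel; every ring
carries one loop of each colour. -/
noncomputable def numLoopsOfColour (D : Diagram) (c : Fin 3) : ℕ :=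
  D.rings + Nat.card
    (Quot fun h k : D.V × Fin 6 => k = D.contr h ∨ k = (h.1, wheel c h.2))

/-- The total number of loops, i.e. the power of `N` of the diagram. -/
noncomputable def numLoops (D : Diagram) : ℕ := ∑ c, D.numLoopsOfColour c

/-- A maximal vacuum diagram: a connected one with the largest number of loops among all connected
ones with the same number of interaction vertices. -/
def IsMaximal (D : Diagram) : Prop :=
  D.Connected ∧
    ∀ D' : Diagram, D'.Connected → D'.numVertices = D.numVertices → D'.numLoops ≤ D.numLoops

/-- Equality of diagrams up to renaming the interaction vertices and relabelling the fields of each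
of them by an automorphism of the wheel. -/
def Iso (D D' : Diagram) : Prop :=
  D.rings = D'.rings ∧
    ∃ (e : D.V ≃ D'.V) (g : D.V → Equiv.Perm (Fin 6)),
      (∀ v, IsAutomorphism (g v)) ∧
      ∀ v i w j, D.contr (v, i) = (w, j) → D'.contr (e v, g v i) = (e w, g w j)

/-- The zeroth-order diagram: a single ring. -/
def ring : Diagram where
  V := Empty
  finite := inferInstance
  contr h := h
  contr_contr h := h.1.elim
  contr_ne h := h.1.elim
  rings := 1

/-- The disjoint union of two diagrams. -/
def disjointUnion (D E : Diagram) : Diagram where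
  V := D.V ⊕ E.V
  finite := by
    have := D.finite
    have := E.finite
    infer_instance
  contr
    | (.inl v, i) => Prod.map .inl id (D.contr (v, i))
    | (.inr w, i) => Prod.map .inr id (E.contr (w, i))
  contr_contr := by
    rintro ⟨v | w, i⟩
    · have := D.contr_contr (v, i)
      simpa [Prod.map, Prod.ext_iff] using this
    · have := E.contr_contr (w, i)
      simpa [Prod.map, Prod.ext_iff] using this
  contr_ne := by
    rintro ⟨v | w, i⟩ h
    · apply D.contr_ne (v, i)
      simpa [Prod.map, Prod.ext_iff] using h
    · apply E.contr_ne (w, i)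
      simpa [Prod.map, Prod.ext_iff] using h
  rings := D.rings + E.rings

open Classical in
/-- Cut the propagators at the fields `h` and `k` and exchange their ends: `h` is contracted with the
former partner of `k`, and `k` with the former partner of `h`.  (If `h` and `k` are partners of each
other, nothing changes.) -/
noncomputable def exchange (D : Diagram) (h k : D.V × Fin 6) : Diagram where
  V := D.V
  finite := D.finite
  contr x := Equiv.swap h k (D.contr (Equiv.swap h k x))
  contr_contr x := by simp [D.contr_contr]
  contr_ne x hx := D.contr_ne (Equiv.swap h k x) (by
    have := congrArg (Equiv.swap h k) hx
    simpa using this)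
  rings := D.rings

end Diagram

/-- A two-point diagram: the diagram with two external legs that results from a vacuum diagram by
cutting open the propagator at the field `cut`; its external legs are the fields `cut` and
`contr cut`. -/
structure TwoPoint extends Diagram where
  /-- one of the two fields that become external legs -/
  cut : V × Fin 6

/-- Apply the permutation `g` to the fields of all interaction vertices. -/
def TwoPoint.recolour (E : TwoPoint) (g : Equiv.Perm (Fin 6)) : TwoPoint where
  V := E.V
  finite := E.finite
  contr h := Prod.map id g (E.contr (h.1, g.symm h.2))
  contr_contr h := by
    have := E.contr_contr (h.1, g.symm h.2)
    simp [this]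
  contr_ne h hh := E.contr_ne (h.1, g.symm h.2) (by
    have := congrArg (Prod.map id g.symm) hh
    simpa [Prod.map] using this)
  rings := E.rings
  cut := (E.cut.1, g E.cut.2)

/-- The elementary snail (labels `1, …, 6`): one vertex with `3` contracted with `6` and `4` with
`5`; the external legs are `1` and `2`. -/
def elementarySnail : TwoPoint where
  V := Unit
  finite := inferInstance
  contr h := ((), ![1, 0, 5, 4, 3, 2] h.2)
  contr_contr := by decide
  contr_ne := by decide
  rings := 0
  cut := ((), 0)

/-- The elementary melon (labels `1, …, 6`): two vertices `L` and `R`, each of the fields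
`2, …, 6` of `L` contracted with the field of the same label of `R`; the external legs are the
fields `1` of `L` and of `R`. -/
def elementaryMelon : TwoPoint where
  V := Bool
  finite := inferInstance
  contr h := (!h.1, h.2)
  contr_contr := by decide
  contr_ne := by decide
  rings := 0
  cut := (false, 0)

/-- The elementary snail, the elementary melon, and their colour permutations. -/
def IsElementary (E : TwoPoint) : Prop :=
  ∃ g, IsColourPermutation g ∧ (E = elementarySnail.recolour g ∨ E = elementaryMelon.recolour g)

namespace Diagram

/-- Replace the propagator at the field `h` by the two-point diagram `E`: the propagator is cut and
its two ends are attached to the external legs of `E`. -/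
noncomputable def replacePropagator (D : Diagram) (h : D.V × Fin 6) (E : TwoPoint) : Diagram :=
  (D.disjointUnion E.toDiagram).exchange (.inl h.1, h.2) (.inr E.cut.1, E.cut.2)

/-- Replace the propagator of one ring by the two-point diagram `E`: the ring disappears, and the
external legs of `E` are joined to each other. -/
def replaceRing (D : Diagram) (E : TwoPoint) : Diagram :=
  { D.disjointUnion E.toDiagram with rings := D.rings - 1 + E.rings }

/-- The diagrams generated from the ring by repeatedly replacing a propagator by an elementary melon,
an elementary snail, or a colour permutation of these. -/
inductive IsMelonic : Diagram → Prop
  | ring : IsMelonic ring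
  | replaceRing (D : Diagram) (E : TwoPoint) (hE : IsElementary E) (hD : IsMelonic D)
      (hr : 0 < D.rings) : IsMelonic (D.replaceRing E)
  | replacePropagator (D : Diagram) (E : TwoPoint) (hE : IsElementary E) (hD : IsMelonic D)
      (h : D.V × Fin 6) : IsMelonic (D.replacePropagator h E)
  | iso (D D' : Diagram) (hD : IsMelonic D) (hDD' : D.Iso D') : IsMelonic D'

end Diagram

end WheelModel

/-! Two colours `c`, `r` of the wheel form one hexagon through its six fields, so propagators
together with these edges form a ribbon graph with one hexagon per vertex. Euler's inequality
(`euler`, `loops_add_loops_le`) gives `loops c + loops r ≤ 2V + 2C` for `V` vertices and `C`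
components; summed over the three pairs of colours, it bounds the total by `3V + 3C`. Joining two
diagrams along a propagator loses one component and one loop of each colour, and the ring, snail and
melon attain the bound. So melonic diagrams are optimal, they exist for every `V`, and maximal means
attaining the bound (`isMaximal_iff_isOptimal`).

The converse is by induction on `V`. If exchanging the ends of two propagators disconnects an
optimal diagram, it is a join of two smaller optimal diagrams (`exists_join`), and joins of melonic
diagrams are melonic (`isMelonic_join`). Otherwise the diagram is tight: the bound for each pair of
colours is saturated and no exchange disconnects, so an exchange that gains a loop of one colour
loses a loop of every other colour (`IsTight.loops_ex`).

A tight diagram has a loop of length one or two, since otherwise there are at most `V` loops of each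
colour (`IsTight.exists_short`). A loop of length one forces the closed snail, because a wrong
contraction could be exchanged so as to gain loops of two colours at once (`IsTight.snail`). For a
loop of length two, planarity makes the graph bipartite; were the neighbouring fields not contracted
as in a melon, the two vertices could be separated from the rest by two exchanges, and a line of the
third colour entering the rest would have no admissible exit (`Ladder.contr_eq`). This forces the
closed melon. -/

namespace WheelModel

open Relation

/-! ### Counting lines, and the effect of exchanging two propagators. -/

section Orbits

variable {X : Type*}

/-- The relation generating the lines which alternate between propagators `x — f x` and internal
steps `R`. -/
def Step (f : X → X) (R : X → X → Prop) : X → X → Prop := fun x y => y = f x ∨ R x y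

/-- The number of lines. -/
noncomputable def orbits (f : X → X) (R : X → X → Prop) : ℕ := Nat.card (Quot (Step f R))

/-- Two points are linked if they lie on the same line. -/
def Linked (f : X → X) (R : X → X → Prop) : X → X → Prop := EqvGen (Step f R)

theorem Linked.refl {f : X → X} {R : X → X → Prop} (x : X) : Linked f R x x := EqvGen.refl x

theorem Linked.symm {f : X → X} {R : X → X → Prop} {x y : X} (h : Linked f R x y) :
    Linked f R y x := EqvGen.symm _ _ h

theorem Linked.trans {f : X → X} {R : X → X → Prop} {x y z : X} (h : Linked f R x y)
    (h' : Linked f R y z) : Linked f R x z := EqvGen.trans _ _ _ h h'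

theorem Linked.contr (f : X → X) (R : X → X → Prop) (x : X) : Linked f R x (f x) :=
  EqvGen.rel _ _ (Or.inl rfl)

theorem Linked.inner {f : X → X} {R : X → X → Prop} {x y : X} (h : R x y) : Linked f R x y :=
  EqvGen.rel _ _ (Or.inr h)

theorem eqvGen_le {r s : X → X → Prop} (h : ∀ x y, r x y → EqvGen s x y) {x y : X}
    (hxy : EqvGen r x y) : EqvGen s x y := by
  induction hxy with
  | rel x y hxy => exact h x y hxy
  | refl x => exact .refl x
  | symm x y _ ih => exact .symm _ _ ih
  | trans x y z _ _ ih ih' => exact .trans _ _ _ ih ih'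

/-- A set closed under the generating steps contains the line of each of its points. -/
theorem EqvGen.mem_iff {r : X → X → Prop} {S : X → Prop} (h : ∀ x y, r x y → (S x ↔ S y)) {x y : X}
    (hxy : EqvGen r x y) : S x ↔ S y := by
  induction hxy with
  | rel x y hxy => exact h x y hxy
  | refl x => rfl
  | symm x y _ ih => exact ih.symm
  | trans x y z _ _ ih ih' => exact ih.trans ih'

theorem card_quot_le [Finite X] {r s : X → X → Prop} (h : ∀ x y, r x y → EqvGen s x y) :
    Nat.card (Quot s) ≤ Nat.card (Quot r) := by
  refine Nat.card_le_card_of_surjective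
    (Quot.lift (Quot.mk s) fun x y hxy => Quot.eqvGen_sound (h x y hxy)) ?_
  rintro ⟨x⟩
  exact ⟨Quot.mk r x, rfl⟩

theorem card_quot_congr [Finite X] {r s : X → X → Prop} (h : ∀ x y, r x y → EqvGen s x y)
    (h' : ∀ x y, s x y → EqvGen r x y) : Nat.card (Quot s) = Nat.card (Quot r) :=
  le_antisymm (card_quot_le h) (card_quot_le h')

/-- The relation `r` together with the pair `(h, k)`. -/
def AddPair (r : X → X → Prop) (h k : X) : X → X → Prop := fun x y => r x y ∨ (x = h ∧ y = k)

theorem card_quot_addPair_of_eqvGen [Finite X] {r : X → X → Prop} {h k : X} (hk : EqvGen r h k) :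
    Nat.card (Quot r) = Nat.card (Quot (AddPair r h k)) := by
  refine card_quot_congr ?_ fun x y hxy => .rel _ _ (Or.inl hxy)
  rintro x y (hxy | ⟨rfl, rfl⟩)
  · exact .rel _ _ hxy
  · exact hk

-- Gluing two distinct classes amounts to deleting the class of `k`, whose points are sent to the
-- class of `h`.
open Classical in
theorem card_quot_addPair_of_not_eqvGen [Finite X] {r : X → X → Prop} {h k : X}
    (hk : ¬ EqvGen r h k) : Nat.card (Quot r) = Nat.card (Quot (AddPair r h k)) + 1 := by
  have hne : Quot.mk r h ≠ Quot.mk r k := fun e => hk (Quot.eqvGen_exact e)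
  let F : Quot r → Quot r := fun q => if q = Quot.mk r k then Quot.mk r h else q
  have hF : ∀ q, F q ≠ Quot.mk r k := by
    intro q
    by_cases hq : q = Quot.mk r k <;> simp [F, hq, hne]
  let toFun : Quot (AddPair r h k) → {q : Quot r // q ≠ Quot.mk r k} :=
    Quot.lift (fun x => ⟨F (Quot.mk r x), hF _⟩) (by
      rintro x y (hxy | ⟨rfl, rfl⟩)
      · rw [Quot.sound hxy]
      · simp [F])
  let invFun : Quot r → Quot (AddPair r h k) :=
    Quot.lift (Quot.mk _) fun x y hxy => Quot.sound (Or.inl hxy)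
  have hinv : ∀ q, invFun (F q) = invFun q := by
    intro q
    by_cases hq : q = Quot.mk r k
    · subst hq
      have : Quot.mk (AddPair r h k) h = Quot.mk _ k := Quot.sound (Or.inr ⟨rfl, rfl⟩)
      simpa [F, invFun] using this
    · simp [F, hq]
  have e : Quot (AddPair r h k) ≃ {q : Quot r // q ≠ Quot.mk r k} :=
    { toFun := toFun
      invFun := fun q => invFun q.1
      left_inv := by
        rintro ⟨x⟩
        exact hinv (Quot.mk r x)
      right_inv := by
        rintro ⟨⟨x⟩, hx⟩
        refine Subtype.ext ?_
        change F (Quot.mk r x) = Quot.mk r x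
        exact if_neg hx }
  have : Fintype (Quot r) := Fintype.ofFinite _
  rw [Nat.card_congr e, Nat.card_eq_fintype_card, Nat.card_eq_fintype_card,
    Fintype.card_subtype_compl, Fintype.card_subtype_eq]
  have : 0 < Fintype.card (Quot r) := Fintype.card_pos_iff.mpr ⟨Quot.mk r h⟩
  omega

open Classical in
/-- Cut the propagators at `h` and `k` and exchange their ends. -/
noncomputable def ex (f : X → X) (h k : X) : X → X :=
  fun x => Equiv.swap h k (f (Equiv.swap h k x))

@[simp]
theorem ex_ex (f : X → X) (h k : X) : ex (ex f h k) h k = f := by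
  funext x
  simp [ex]

open Classical in
theorem orbits_eq_add [Finite X] (f : X → X) (R : X → X → Prop) (h k : X) :
    orbits f R = Nat.card (Quot (AddPair (Step f R) h k)) + if Linked f R h k then 0 else 1 := by
  split_ifs with hk
  · exact card_quot_addPair_of_eqvGen hk
  · exact card_quot_addPair_of_not_eqvGen hk

/-- Once `h` and `k` are glued, swapping them moves no point out of its class, so conjugating `f` by
the swap is invisible. -/
theorem eqvGen_addPair_ex (f : X → X) (R : X → X → Prop) (h k : X) (x y : X)
    (hxy : AddPair (Step f R) h k x y) : EqvGen (AddPair (Step (ex f h k) R) h k) x y := by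
  classical
  have hs : ∀ z, EqvGen (AddPair (Step (ex f h k) R) h k) z (Equiv.swap h k z) := by
    intro z
    have hhk : EqvGen (AddPair (Step (ex f h k) R) h k) h k := .rel _ _ (Or.inr ⟨rfl, rfl⟩)
    by_cases hz : z = h
    · subst hz
      simpa using hhk
    by_cases hz' : z = k
    · subst hz'
      simpa using hhk.symm
    rw [Equiv.swap_apply_of_ne_of_ne hz hz']
    exact .refl _
  rcases hxy with (rfl | hxy) | hxy
  · have h1 := hs x
    have h2 : EqvGen (AddPair (Step (ex f h k) R) h k) (Equiv.swap h k x)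
      (ex f h k (Equiv.swap h k x)) := .rel _ _ (Or.inl (Or.inl rfl))
    have h3 := hs (ex f h k (Equiv.swap h k x))
    have h4 : Equiv.swap h k (ex f h k (Equiv.swap h k x)) = f x := by simp [ex]
    rw [h4] at h3
    exact (h1.trans _ _ _ h2).trans _ _ _ h3
  · exact .rel _ _ (Or.inl (Or.inr hxy))
  · exact .rel _ _ (Or.inr hxy)

theorem card_addPair_ex [Finite X] (f : X → X) (R : X → X → Prop) (h k : X) :
    Nat.card (Quot (AddPair (Step (ex f h k) R) h k)) =
      Nat.card (Quot (AddPair (Step f R) h k)) := by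
  refine card_quot_congr (eqvGen_addPair_ex f R h k) fun x y hxy => ?_
  have := eqvGen_addPair_ex (ex f h k) R h k x y hxy
  rwa [ex_ex] at this

-- Both counts are compared with the common number of lines after gluing `h` to `k`; each exceeds it
-- by one exactly when `h` and `k` lie on different lines.
open Classical in
theorem orbits_ex [Finite X] (f : X → X) (R : X → X → Prop) (h k : X) :
    orbits (ex f h k) R + (if Linked f R h k then 0 else 1) =
      orbits f R + if Linked (ex f h k) R h k then 0 else 1 := by
  rw [orbits_eq_add f R h k, orbits_eq_add (ex f h k) R h k, card_addPair_ex]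
  omega

/-- A perfect matching: an involution without fixed points. -/
structure IsPairing (f : X → X) : Prop where
  invol : ∀ x, f (f x) = x
  ne : ∀ x, f x ≠ x

theorem IsPairing.ex {f : X → X} (hf : IsPairing f) (h k : X) : IsPairing (ex f h k) := by
  classical
  refine ⟨fun x => by simp [WheelModel.ex, hf.invol], fun x hx => hf.ne (Equiv.swap h k x) ?_⟩
  have := congrArg (Equiv.swap h k) hx
  simpa [WheelModel.ex] using this

theorem IsPairing.eq_comm {f : X → X} (hf : IsPairing f) {x y : X} : f x = y ↔ f y = x :=
  ⟨fun h => h ▸ hf.invol x, fun h => h ▸ hf.invol y⟩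

theorem IsPairing.injective {f : X → X} (hf : IsPairing f) : Function.Injective f :=
  Function.LeftInverse.injective hf.invol

theorem ex_apply_of_ne {f : X → X} (hf : IsPairing f) {h k x : X} (h1 : x ≠ h) (h2 : x ≠ k)
    (h3 : x ≠ f h) (h4 : x ≠ f k) : ex f h k x = f x := by
  classical
  rw [ex, Equiv.swap_apply_of_ne_of_ne h1 h2, Equiv.swap_apply_of_ne_of_ne]
  · exact fun e => h3 (by rw [← e, hf.invol])
  · exact fun e => h4 (by rw [← e, hf.invol])

theorem ex_eq_ex_contr {f : X → X} (hf : IsPairing f) (h k : X) : ex f h k = ex f (f h) (f k) := by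
  classical
  funext x
  simp only [ex]
  have hi := hf.invol
  have hn := hf.ne
  have hj := hf.injective
  simp only [Equiv.swap_apply_def]
  grind

theorem IsPairing.sum_eq_zero {M : Type*} [AddCommMonoid M] {f : X → X} (hf : IsPairing f)
    (S : Finset X) (hS : ∀ z ∈ S, f z ∈ S) (ε : X → M) (hε : ∀ z ∈ S, ε z + ε (f z) = 0) :
    ∑ z ∈ S, ε z = 0 :=
  Finset.sum_involution (fun z _ => f z) hε (fun z _ _ => hf.ne z) hS fun z _ => hf.invol z

/-- A set cannot be closed under a pairing and also be closed under a pairing up to one point. -/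
theorem IsPairing.false_of_closed_except [Finite X] {f w : X → X} (hf : IsPairing f)
    (hw : IsPairing w) (S : X → Prop) (h : X) (hh : S h) (hwS : ∀ z, S z → S (w z))
    (hfS : ∀ z, S z → z ≠ h → S (f z)) (hfh : ¬ S (f h)) : False := by
  classical
  have : Fintype X := Fintype.ofFinite X
  have h1 := hw.sum_eq_zero (Finset.univ.filter S) (by simpa using hwS) (fun _ => (1 : ZMod 2))
    (fun _ _ => by decide)
  have h2 := hf.sum_eq_zero ((Finset.univ.filter S).erase h) (by
    intro z hz
    simp only [Finset.mem_erase, Finset.mem_filter, Finset.mem_univ, true_and] at hz ⊢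
    refine ⟨?_, hfS z hz.2 hz.1⟩
    rintro rfl
    exact hfh (by rw [hf.invol]; exact hz.2)) (fun _ => (1 : ZMod 2)) (fun _ _ => by decide)
  rw [← Finset.add_sum_erase _ _ (by simpa using hh : h ∈ Finset.univ.filter S), h2] at h1
  exact absurd h1 (by decide)

/-- Exchanging the ends of two propagators on different lines merges these lines. -/
theorem linked_ex_of_not_linked [Finite X] {f w : X → X} (hf : IsPairing f) (hw : IsPairing w)
    {R : X → X → Prop} (hR : ∀ x, R x (w x)) {h k : X} (hk : ¬ Linked f R h k) :
    Linked (ex f h k) R h k := by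
  classical
  by_contra hk'
  have hne : h ≠ k := fun e => hk (e ▸ Linked.refl h)
  have hfhk : f h ≠ k := fun e => hk (e ▸ Linked.contr f R h)
  have e1 : ex f h k h = f k := by
    simp [ex]
    rw [Equiv.swap_apply_of_ne_of_ne]
    · exact fun e => hfhk (by rw [← e, hf.invol])
    · exact hf.ne k
  have e2 : ex f h k k = f h := by
    simp [ex]
    rw [Equiv.swap_apply_of_ne_of_ne (hf.ne h) hfhk]
  have l1 : Linked (ex f h k) R h (f k) := e1 ▸ Linked.contr (ex f h k) R h
  have l2 : Linked (ex f h k) R k (f h) := e2 ▸ Linked.contr (ex f h k) R k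
  -- The points linked to `h` both before and after the exchange are closed under `w`, hence even in
  -- number, but only `h` has its `f`-partner outside, which makes the number odd.
  refine hf.false_of_closed_except hw (fun z => Linked f R z h ∧ Linked (ex f h k) R z h) h
    ⟨.refl h, .refl h⟩ ?_ ?_ ?_
  · rintro z ⟨h1, h2⟩
    exact ⟨(Linked.inner (hR z)).symm.trans h1, (Linked.inner (hR z)).symm.trans h2⟩
  · rintro z ⟨h1, h2⟩ hz
    refine ⟨(Linked.contr f R z).symm.trans h1, ?_⟩
    have : ex f h k z = f z := by
      refine ex_apply_of_ne hf hz ?_ ?_ ?_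
      · rintro rfl
        exact hk h1.symm
      · rintro rfl
        exact hk' (l2.trans h2).symm
      · rintro rfl
        exact hk ((Linked.contr f R k).trans h1).symm
    rw [← this]
    exact (Linked.contr (ex f h k) R z).symm.trans h2
  · rintro ⟨-, h2⟩
    exact hk' (l2.trans h2).symm

theorem orbits_ex_of_not_linked [Finite X] {f w : X → X} (hf : IsPairing f) (hw : IsPairing w)
    {R : X → X → Prop} (hR : ∀ x, R x (w x)) {h k : X} (hk : ¬ Linked f R h k) :
    orbits (ex f h k) R + 1 = orbits f R := by
  have := orbits_ex f R h k
  rw [if_neg hk, if_pos (linked_ex_of_not_linked hf hw hR hk)] at this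
  simpa using this

theorem orbits_ex_of_not_linked_ex [Finite X] {f w : X → X} (hf : IsPairing f) (hw : IsPairing w)
    {R : X → X → Prop} (hR : ∀ x, R x (w x)) {h k : X} (hk : ¬ Linked (ex f h k) R h k) :
    orbits (ex f h k) R = orbits f R + 1 := by
  have := orbits_ex_of_not_linked (hf.ex h k) hw hR hk
  rw [ex_ex] at this
  exact this.symm

theorem orbits_le_orbits_ex_add_one [Finite X] (f : X → X) (R : X → X → Prop) (h k : X) :
    orbits f R ≤ orbits (ex f h k) R + 1 := by
  have := orbits_ex f R h k
  split_ifs at this <;> omega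

theorem orbits_ex_le_of_linked_ex [Finite X] {f : X → X} {R : X → X → Prop} {h k : X}
    (hk : Linked (ex f h k) R h k) : orbits (ex f h k) R ≤ orbits f R := by
  have := orbits_ex f R h k
  split_ifs at this <;> omega

theorem orbits_le_orbits_ex_of_linked [Finite X] {f : X → X} {R : X → X → Prop} {h k : X}
    (hk : Linked f R h k) : orbits f R ≤ orbits (ex f h k) R := by
  have := orbits_ex f R h k
  split_ifs at this
  all_goals omega

/-- If every line has at least `m` points, there are at most `|X| / m` lines. -/
theorem mul_card_quot_le [Finite X] (r : X → X → Prop) (m : ℕ)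
    (h : ∀ x, ∃ S : Finset X, m ≤ S.card ∧ ∀ y ∈ S, EqvGen r x y) :
    m * Nat.card (Quot r) ≤ Nat.card X := by
  classical
  have : Fintype X := Fintype.ofFinite X
  have : Fintype (Quot r) := Fintype.ofFinite _
  rw [Nat.card_eq_fintype_card, Nat.card_eq_fintype_card, ← Finset.card_univ,
    ← Finset.card_univ (α := X)]
  refine Finset.mul_card_image_le_card_of_maps_to (f := Quot.mk r) (fun _ _ => Finset.mem_univ _)
    m ?_
  rintro ⟨x⟩ -
  obtain ⟨S, hS, hS'⟩ := h x
  refine hS.trans (Finset.card_le_card fun y hy => ?_)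
  simp only [Finset.mem_filter, Finset.mem_univ, true_and]
  exact (Quot.eqvGen_sound (hS' y hy)).symm

end Orbits

/-! ### Euler's inequality for three matchings, and bipartiteness in the planar case. -/

section Euler

variable {X : Type*}

/-- The relation given by the graph of a map. -/
def Via (w : X → X) : X → X → Prop := fun x y => y = w x

/-- A sign `ε` is flipped by the map `f`. -/
def Flips (ε : X → ℤ) (f : X → X) : Prop := ∀ x, ε (f x) = -ε x

/-- A function with values `±1`. -/
def IsSign (ε : X → ℤ) : Prop := ∀ x, ε x = 1 ∨ ε x = -1

theorem linked_iff_of_linked {f : X → X} {R : X → X → Prop} {x y z : X} (hxy : Linked f R x y) :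
    Linked f R z x ↔ Linked f R z y :=
  ⟨fun h => h.trans hxy, fun h => h.trans hxy.symm⟩

theorem linked_mono {f : X → X} {R R' : X → X → Prop} (hR : ∀ x y, R x y → R' x y) {x y : X}
    (h : Linked f R x y) : Linked f R' x y :=
  eqvGen_le (fun x y hxy => .rel x y (hxy.imp_right (hR x y))) h

theorem ex_apply_left {f : X → X} (hf : IsPairing f) {h k : X} (hk : f h ≠ k) :
    ex f h k h = f k := by
  classical
  simp only [ex, Equiv.swap_apply_left]
  rw [Equiv.swap_apply_of_ne_of_ne]
  · exact fun e => hk (by rw [← e, hf.invol])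
  · exact hf.ne k

theorem ex_apply_right {f : X → X} (hf : IsPairing f) {h k : X} (hk : f h ≠ k) :
    ex f h k k = f h := by
  classical
  simp only [ex, Equiv.swap_apply_right]
  rw [Equiv.swap_apply_of_ne_of_ne (hf.ne h) hk]

/-- The signs on `S` cancel along `c`; those away from `p` and `q` also cancel along `a`, so the
contributions of `p` and `q` must cancel. It says that the two ends of an open line have opposite
signs. -/
theorem sum_mem_eq_zero [Finite X] {a c : X → X} (ha : IsPairing a) (hc : IsPairing c)
    {ε : X → ℤ} (S : X → Prop) (p q : X) (hpq : p ≠ q) (hcS : ∀ z, S z → S (c z))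
    (hcε : Flips ε c) (haS : ∀ z, S z → z ≠ p → z ≠ q → S (a z) ∧ a z ≠ p ∧ a z ≠ q)
    (haε : ∀ z, S z → z ≠ p → z ≠ q → ε (a z) = -ε z) [DecidablePred S] :
    (if S p then ε p else 0) + (if S q then ε q else 0) = 0 := by
  classical
  have : Fintype X := Fintype.ofFinite X
  have h1 := hc.sum_eq_zero (Finset.univ.filter S) (by simpa using hcS) ε
    (fun z _ => by rw [hcε z]; ring)
  have h2 := ha.sum_eq_zero (Finset.univ.filter fun z => S z ∧ z ≠ p ∧ z ≠ q) (by
      intro z hz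
      simp only [Finset.mem_filter, Finset.mem_univ, true_and] at hz ⊢
      exact haS z hz.1 hz.2.1 hz.2.2) ε
    (fun z hz => by
      simp only [Finset.mem_filter, Finset.mem_univ, true_and] at hz
      rw [haε z hz.1 hz.2.1 hz.2.2]; ring)
  rw [Finset.sum_filter] at h1 h2
  have h3 : ∀ z, (if S z then ε z else 0) = (if S z ∧ z ≠ p ∧ z ≠ q then ε z else 0) +
      ((if z = p then (if S p then ε p else 0) else 0) +
        (if z = q then (if S q then ε q else 0) else 0)) := by
    intro z
    by_cases h1 : z = p
    · subst h1
      simp [hpq]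
    by_cases h2 : z = q
    · subst h2
      simp [h1]
    simp [h1, h2]
  rw [Finset.sum_congr rfl fun z _ => h3 z, Finset.sum_add_distrib, h2, Finset.sum_add_distrib,
    Finset.sum_ite_eq' , Finset.sum_ite_eq'] at h1
  simpa using h1

theorem IsPairing.two_mul_orbits_le [Finite X] {b : X → X} (hb : IsPairing b) (R : X → X → Prop) :
    2 * orbits b R ≤ Nat.card X := by
  classical
  refine mul_card_quot_le _ 2 fun x => ⟨{x, b x}, ?_, ?_⟩
  · rw [Finset.card_pair (hb.ne x).symm]
  · intro y hy
    simp only [Finset.mem_insert, Finset.mem_singleton] at hy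
    rcases hy with rfl | rfl
    · exact .refl _
    · exact Linked.contr b R x

/-- The sign of a diagram can be transported through an exchange. -/
theorem flips_of_flips_ex {a : X → X} (ha : IsPairing a) {h k : X} {ε : X → ℤ}
    (h1 : ∀ z, z ≠ h → z ≠ k → z ≠ a h → z ≠ a k → ε (a z) = -ε z) (h2 : ε (a h) = -ε h)
    (h3 : ε (a k) = -ε k) : Flips ε a := by
  intro z
  by_cases z1 : z = h
  · rw [z1, h2]
  by_cases z2 : z = k
  · rw [z2, h3]
  by_cases z3 : z = a h
  · rw [z3, ha.invol, h2, neg_neg]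
  by_cases z4 : z = a k
  · rw [z4, ha.invol, h3, neg_neg]
  exact h1 z z1 z2 z3 z4

/-- Euler's inequality for three perfect matchings; in the case of equality the graph which they
form is bipartite. -/
theorem euler [Finite X] {b c : X → X} (hb : IsPairing b) (hc : IsPairing c) (ε₀ : X → ℤ)
    (hε₀ : IsSign ε₀) (hbε : Flips ε₀ b) (hcε : Flips ε₀ c) {a : X → X} (ha : IsPairing a) :
    2 * orbits a (Via b) + 2 * orbits a (Via c) + 2 * orbits b (Via c) ≤
        Nat.card X + 4 * orbits a (Step b (Via c)) ∧
      (2 * orbits a (Via b) + 2 * orbits a (Via c) + 2 * orbits b (Via c) =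
          Nat.card X + 4 * orbits a (Step b (Via c)) →
        ∃ ε, IsSign ε ∧ Flips ε a ∧ Flips ε b ∧ Flips ε c) := by
  classical
  -- The induction turns `a` into `b` one propagator at a time; for `a = b` the lines of colours
  -- `a`, `c` are the components.
  generalize hn : Nat.card {z // a z ≠ b z} = n
  induction n using Nat.strong_induction_on generalizing a with
  | _ n ih =>
  by_cases hab : ∀ x, a x = b x
  · obtain rfl : a = b := funext hab
    have h1 : orbits a (Step a (Via c)) = orbits a (Via c) := by
      refine card_quot_congr (fun x y hxy => .rel _ _ (Or.inr hxy)) ?_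
      rintro x y (rfl | hxy)
      · exact Linked.contr a (Via c) x
      · exact .rel _ _ hxy
    have h2 := hb.two_mul_orbits_le (Via a)
    exact ⟨by omega, fun _ => ⟨ε₀, hε₀, hbε, hbε, hcε⟩⟩
  push Not at hab
  obtain ⟨x, hx⟩ := hab
  set h := a x with hh
  set k := b x with hk
  have hah : a h = x := ha.invol x
  have hbk : b k = x := hb.invol x
  have hxh : x ≠ h := (ha.ne x).symm
  have hxk : x ≠ k := (hb.ne x).symm
  have hak : a k ≠ x := fun e => hx (by rw [hh, ← e, ha.invol])
  have hah' : a h ≠ k := by rw [hah]; exact hxk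
  -- The new matching pairs `x` with `b x`, and `a x` with `a (b x)`, so it agrees with `b` at one
  -- more pair.
  set a' := ex a h k with ha'
  have hpa' : IsPairing a' := ha.ex h k
  have a'h : a' h = a k := ex_apply_left ha hah'
  have a'k : a' k = x := by rw [ha', ex_apply_right ha hah', hah]
  have a'x : a' x = k := by rw [← a'k, hpa'.invol]
  have a'ne : ∀ z, z ≠ h → z ≠ k → z ≠ x → z ≠ a k → a' z = a z := fun z z1 z2 z3 z4 =>
    ex_apply_of_ne ha z1 z2 (by rwa [hah]) z4
  have hcard : Nat.card {z // a' z ≠ b z} < n := by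
    rw [← hn]
    refine Set.ncard_lt_ncard (s := {z | a' z ≠ b z}) (t := {z | a z ≠ b z})
      ((Set.ssubset_iff_of_subset ?_).mpr ⟨x, hx, fun h' => h' a'x⟩)
    intro z (hz : a' z ≠ b z) (hz' : a z = b z)
    refine hz ?_
    rw [← hz']
    refine a'ne z ?_ ?_ ?_ ?_
    · rintro rfl
      rw [hah, eq_comm, hb.eq_comm] at hz'
      exact hx hz'.symm
    · rintro rfl
      rw [hbk] at hz'
      exact hak hz'
    · rintro rfl
      exact hx hz'
    · rintro rfl
      rw [ha.invol] at hz'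
      exact hak (hb.injective hz'.symm |>.trans rfl)
  obtain ⟨ih1, ih2⟩ := ih _ hcard hpa' rfl
  -- the line of colours `a`, `b` splits
  have hab1 : orbits a' (Via b) = orbits a (Via b) + 1 := by
    refine orbits_ex_of_not_linked_ex ha hb (R := Via b) (fun _ => rfl) fun hl => ?_
    have := (EqvGen.mem_iff (S := fun z => z = x ∨ z = k) ?_ hl).mpr (Or.inr rfl)
    · rcases this with e | e
      · exact hxh e.symm
      · exact hx e
    · rintro y z (rfl | rfl)
      · change _ ↔ a' y = x ∨ a' y = k
        rw [hpa'.eq_comm (y := x), hpa'.eq_comm (y := k), a'x, a'k]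
        exact ⟨fun h => h.symm.imp Eq.symm Eq.symm, fun h => h.symm.imp Eq.symm Eq.symm⟩
      · rw [hb.eq_comm (y := x), hb.eq_comm (y := k), hbk]
        exact ⟨fun h => h.symm.imp Eq.symm Eq.symm, fun h => h.symm.imp Eq.symm Eq.symm⟩
  have hVc : ∀ x, Via c x (c x) := fun _ => rfl
  have hlk : Linked a (Step b (Via c)) h k :=
    (Linked.contr a _ x).symm.trans (Linked.inner (Or.inl rfl))
  have hle : orbits a (Step b (Via c)) ≤ orbits a' (Step b (Via c)) :=
    orbits_le_orbits_ex_of_linked hlk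
  by_cases hl : Linked a' (Step b (Via c)) h k
  · have hle' : orbits a' (Step b (Via c)) ≤ orbits a (Step b (Via c)) :=
      orbits_ex_le_of_linked_ex hl
    -- The components are unchanged. If the number of `a`, `c` lines does not fall, then the gain in
    -- `a`, `b` lines makes the inequality for `a` strict.
    by_cases hac : Linked a (Via c) h k
    · have : orbits a (Via c) ≤ orbits a' (Via c) := orbits_le_orbits_ex_of_linked hac
      exact ⟨by omega, by omega⟩
    · have h1 : orbits a' (Via c) + 1 = orbits a (Via c) :=
        orbits_ex_of_not_linked ha hc (R := Via c) hVc hac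
      refine ⟨by omega, fun heq => ?_⟩
      obtain ⟨ε, hε, hεa, hεb, hεc⟩ := ih2 (by omega)
      refine ⟨ε, hε, ?_, hεb, hεc⟩
      -- On the `a`, `c` line of `h`, which avoids `k`, all points but `h` and `x` cancel, so the
      -- sign for `a'` is also flipped between `h` and `x = a h`.
      have hsum := sum_mem_eq_zero ha hc (ε := ε) (fun z => Linked a (Via c) h z) h x hxh.symm
        (fun z hz => hz.trans (Linked.inner (hVc z))) hεc ?_ ?_
      · rw [if_pos (Linked.refl h), if_pos (Linked.contr a _ x).symm] at hsum
        refine flips_of_flips_ex ha (h := h) (k := k) ?_ ?_ ?_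
        · intro z z1 z2 z3 z4
          rw [hah] at z3
          rw [← a'ne z z1 z2 z3 z4, hεa]
        · rw [hah]
          linarith
        · have e1 := hεa h
          have e2 := hεb x
          rw [a'h] at e1
          rw [e1, ← hk] at *
          linarith
      · intro z hz z1 z2
        refine ⟨hz.trans (Linked.contr a _ z), ?_, ?_⟩
        · rw [Ne, ha.eq_comm, hah]
          exact z2.symm
        · rw [Ne, ha.eq_comm]
          exact z1.symm
      · intro z hz z1 z2
        rw [← a'ne z z1 ?_ z2 ?_, hεa]
        · rintro rfl
          exact hac hz
        · rintro rfl
          exact hac (hz.trans (Linked.contr a _ k).symm)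
  · have h1 : orbits a' (Step b (Via c)) = orbits a (Step b (Via c)) + 1 :=
      orbits_ex_of_not_linked_ex ha hb (R := Step b (Via c)) (fun _ => Or.inl rfl) hl
    have h2 : orbits a' (Via c) = orbits a (Via c) + 1 :=
      orbits_ex_of_not_linked_ex ha hc hVc fun h' => hl (linked_mono (fun _ _ => Or.inr) h')
    refine ⟨by omega, fun heq => ?_⟩
    obtain ⟨ε, hε, hεa, hεb, hεc⟩ := ih2 (by omega)
    set L := Linked a' (Step b (Via c)) h with hL
    have hLk : ¬ L k := hl
    have hLx : ¬ L x := fun h' => hl (h'.trans (a'x ▸ Linked.contr a' _ x))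
    have hLm : L (a k) := a'h ▸ Linked.contr a' _ h
    have hsq : ε h * ε h = 1 := by rcases hε h with e | e <;> rw [e] <;> norm_num
    -- The exchange splits a component, so the sign can be adjusted on the part containing `h`. The
    -- factor `-ε h * ε x` gives `h` the sign opposite to that of `x`.
    have hflip : ∀ z w, ε w = -ε z → (L w ↔ L z) →
        (if L w then ε w * (-ε h * ε x) else ε w) = -(if L z then ε z * (-ε h * ε x) else ε z) := by
      intro z w hzw hLz
      by_cases hz : L z
      · rw [if_pos hz, if_pos (hLz.mpr hz), hzw]
        ring
      · rw [if_neg hz, if_neg (fun h' => hz (hLz.mp h')), hzw]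
    refine ⟨fun z => if L z then ε z * (-ε h * ε x) else ε z, ?_, ?_, ?_, ?_⟩
    · intro z
      rcases hε z with e | e <;> rcases hε h with e' | e' <;> rcases hε x with e'' | e'' <;>
        by_cases hz : L z <;> simp [hz, e, e', e'']
    · refine flips_of_flips_ex ha (h := h) (k := k) ?_ ?_ ?_
      · intro z z1 z2 z3 z4
        rw [hah] at z3
        have e := a'ne z z1 z2 z3 z4
        rw [← e]
        exact hflip z _ (hεa z) (linked_iff_of_linked (Linked.contr a' _ z)).symm
      · simp only [hah]
        rw [if_neg hLx, if_pos (show L h from Linked.refl h)]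
        linear_combination (-ε x) * hsq
      · rw [if_neg hLk, if_pos hLm]
        have e1 := hεa h
        have e2 := hεb x
        rw [a'h] at e1
        rw [← hk] at e2
        rw [e1, e2]
        linear_combination (ε x) * hsq
    · intro z
      exact hflip z _ (hεb z) (linked_iff_of_linked (Linked.inner
        (R := Step b (Via c)) (x := z) (y := b z) (Or.inl rfl))).symm
    · intro z
      exact hflip z _ (hεc z) (linked_iff_of_linked (Linked.inner
        (R := Step b (Via c)) (x := z) (y := c z) (Or.inr rfl))).symm

end Euler

/-! ### Combinatorics of the wheel. -/

theorem wheel_wheel (c : Fin 3) (i : Fin 6) : wheel c (wheel c i) = i := by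
  revert c i; decide

theorem wheel_ne (c : Fin 3) (i : Fin 6) : wheel c i ≠ i := by
  revert c i; decide

/-- The three colours act on the six fields as the three reflections of `S₃`, where conjugating one
reflection by another gives the third. -/
theorem wheel_comm {c r b : Fin 3} (h1 : c ≠ r) (h2 : b ≠ c) (h3 : b ≠ r) (i : Fin 6) :
    wheel r (wheel c i) = wheel b (wheel r i) := by
  revert c r b i; decide

theorem wheel_reach {c r : Fin 3} (h : c ≠ r) (i j : Fin 6) :
    j = i ∨ j = wheel c i ∨ j = wheel r i ∨ j = wheel c (wheel r i) ∨ j = wheel r (wheel c i) ∨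
      j = wheel c (wheel r (wheel c i)) := by
  revert c r i j; decide

/-- The two classes of fields of the wheel, as signs. -/
def fieldSign (i : Fin 6) : ℤ := if i.val % 2 = 0 then 1 else -1

theorem fieldSign_wheel (c : Fin 3) (i : Fin 6) : fieldSign (wheel c i) = -fieldSign i := by
  revert c i; decide

theorem exists_wheel_eq {i j : Fin 6} (h : fieldSign i = -fieldSign j) : ∃ c, wheel c i = j := by
  revert i j; decide

theorem fieldSign_eq_or (i : Fin 6) : fieldSign i = 1 ∨ fieldSign i = -1 := by
  revert i; decide

theorem exists_third_colour (c r : Fin 3) : ∃ b : Fin 3, b ≠ c ∧ b ≠ r := by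
  revert c r; decide

theorem wheel_ne_wheel {c r : Fin 3} (h : c ≠ r) (i : Fin 6) : wheel c i ≠ wheel r i := by
  revert c r i; decide

/-! ### Loop bounds, tight diagrams and snails. -/

section Matching

variable {V : Type*}

/-- The edges of colour `c` inside the vertices. -/
def edge (c : Fin 3) (x : V × Fin 6) : V × Fin 6 := (x.1, wheel c x.2)

theorem isPairing_edge (c : Fin 3) : IsPairing (edge c : V × Fin 6 → V × Fin 6) :=
  ⟨fun x => Prod.ext rfl (wheel_wheel c x.2), fun x h => wheel_ne c x.2 (congrArg Prod.snd h)⟩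

theorem edge_comm {c r b : Fin 3} (h1 : c ≠ r) (h2 : b ≠ c) (h3 : b ≠ r) (x : V × Fin 6) :
    edge r (edge c x) = edge b (edge r x) := Prod.ext rfl (wheel_comm h1 h2 h3 x.2)

/-- Two fields belong to the same vertex. -/
def SameVertex (x y : V × Fin 6) : Prop := x.1 = y.1

/-- Two fields of opposite sign of the same vertex are joined by an edge. -/
theorem exists_edge_eq {ε : V × Fin 6 → ℤ} (hε : IsSign ε) (hεe : ∀ c, Flips ε (edge c))
    {x y : V × Fin 6} (hxy : x.1 = y.1) (h : ε x = -ε y) : ∃ c, edge c x = y := by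
  obtain ⟨v, i⟩ := x
  obtain ⟨w, j⟩ := y
  obtain rfl : v = w := hxy
  have key : ∀ c k, ε (v, wheel c k) = -ε (v, k) := fun c k => hεe c (v, k)
  have : fieldSign i = -fieldSign j := by
    rcases wheel_reach (c := 0) (r := 1) (by decide) i j with hj | hj | hj | hj | hj | hj <;>
    rcases hε (v, i) with e | e <;>
    simp only [hj, key, e, fieldSign_wheel, neg_neg] at h ⊢ <;> norm_num at h
  obtain ⟨c, hc⟩ := exists_wheel_eq this
  exact ⟨c, Prod.ext rfl hc⟩

/-- The number of loops of colour `c` that go through vertices. -/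
noncomputable def loops (f : V × Fin 6 → V × Fin 6) (c : Fin 3) : ℕ := orbits f (Via (edge c))

/-- The number of components with vertices. -/
noncomputable def comps (f : V × Fin 6 → V × Fin 6) : ℕ := orbits f SameVertex

theorem linked_of_sameVertex (f : V × Fin 6 → V × Fin 6) {c r : Fin 3} (hcr : c ≠ r)
    {x y : V × Fin 6} (h : x.1 = y.1) : Linked f (Step (edge c) (Via (edge r))) x y := by
  have hc : ∀ x, Linked f (Step (edge c) (Via (edge r))) x (edge c x) :=
    fun x => Linked.inner (Or.inl rfl)
  have hr : ∀ x, Linked f (Step (edge c) (Via (edge r))) x (edge r x) :=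
    fun x => Linked.inner (Or.inr rfl)
  obtain ⟨v, i⟩ := x
  obtain ⟨w, j⟩ := y
  obtain rfl : v = w := h
  rcases wheel_reach hcr i j with rfl | rfl | rfl | rfl | rfl | rfl
  · exact .refl _
  · exact hc (v, i)
  · exact hr (v, i)
  · exact (hr (v, i)).trans (hc _)
  · exact (hc (v, i)).trans (hr _)
  · exact ((hc (v, i)).trans (hr _)).trans (hc _)

theorem linked_sameVertex_of_linked {f : V × Fin 6 → V × Fin 6} {c : Fin 3} {x y : V × Fin 6}
    (h : Linked f (Via (edge c)) x y) : Linked f SameVertex x y :=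
  linked_mono (fun x y (hxy : y = edge c x) => by rw [hxy]; rfl) h

variable {f : V × Fin 6 → V × Fin 6}

/-- Two vertices joined by two propagators `m — m'`, `n — n'` at the ends of an edge of the third
colour; `p — m`, `q — n` have colour `r` and `p — q` has colour `b`. -/
structure Ladder (f : V × Fin 6 → V × Fin 6) (r b : Fin 3) (p q m n p' q' m' n' : V × Fin 6) :
    Prop where
  rp : edge r p = m
  rq : edge r q = n
  bp : edge b p = q
  rp' : edge r p' = m'
  rq' : edge r q' = n'
  bp' : edge b p' = q'
  fm : f m = m'
  fn : f n = n'
  ne : p.1 ≠ p'.1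

theorem Ladder.symm {r b : Fin 3} {p q m n p' q' m' n' : V × Fin 6}
    (L : Ladder f r b p q m n p' q' m' n') : Ladder f r b q p n m q' p' n' m' where
  rp := L.rq
  rq := L.rp
  bp := by rw [← L.bp, (isPairing_edge b).invol]
  rp' := L.rq'
  rq' := L.rp'
  bp' := by rw [← L.bp', (isPairing_edge b).invol]
  fm := L.fn
  fn := L.fm
  ne := by
    rw [← L.bp, ← L.bp']
    exact L.ne

theorem Ladder.ne_of_fst {r b : Fin 3} {p q m n p' q' m' n' : V × Fin 6}
    (L : Ladder f r b p q m n p' q' m' n') :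
    ∀ x ∈ [p, q, m, n], ∀ y ∈ [p', q', m', n'], x ≠ y := by
  have h1 : q.1 = p.1 := by rw [← L.bp]; rfl
  have h2 : m.1 = p.1 := by rw [← L.rp]; rfl
  have h3 : n.1 = p.1 := by rw [← L.rq]; exact h1
  have h1' : q'.1 = p'.1 := by rw [← L.bp']; rfl
  have h2' : m'.1 = p'.1 := by rw [← L.rp']; rfl
  have h3' : n'.1 = p'.1 := by rw [← L.rq']; exact h1'
  have := L.ne
  intro x hx y hy e
  have e := congrArg Prod.fst e
  simp only [List.mem_cons, List.not_mem_nil, or_false] at hx hy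
  rcases hx with rfl | rfl | rfl | rfl <;> rcases hy with rfl | rfl | rfl | rfl <;> grind

variable [Finite V]

/-- Euler's inequality for the ribbon graph of two of the colours. -/
theorem loops_add_loops_le {f : V × Fin 6 → V × Fin 6} (hf : IsPairing f) {c r : Fin 3}
    (hcr : c ≠ r) :
    loops f c + loops f r ≤ 2 * Nat.card V + 2 * comps f ∧
      (loops f c + loops f r = 2 * Nat.card V + 2 * comps f →
        ∃ ε, IsSign ε ∧ Flips ε f ∧ Flips ε (edge c) ∧ Flips ε (edge r)) := by
  have h1 := euler (isPairing_edge c) (isPairing_edge r) (fun x => fieldSign x.2)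
    (fun x => fieldSign_eq_or x.2) (fun x => fieldSign_wheel c x.2)
    (fun x => fieldSign_wheel r x.2) hf
  -- Each vertex contributes a bicoloured hexagon, which no line of colours `c`, `r` can leave.
  have h2 : Nat.card V ≤ orbits (edge c) (Via (edge r : V × Fin 6 → _)) := by
    refine Nat.card_le_card_of_surjective (Quot.lift Prod.fst ?_) fun v => ⟨Quot.mk _ (v, 0), rfl⟩
    rintro x y (rfl | rfl) <;> rfl
  have h3 : orbits f (Step (edge c) (Via (edge r))) ≤ comps f := by
    refine card_quot_le ?_
    rintro x y (rfl | hxy)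
    · exact Linked.contr f _ x
    · exact linked_of_sameVertex f hcr hxy
  have h4 : Nat.card (V × Fin 6) = 6 * Nat.card V := by
    rw [Nat.card_prod, Nat.card_eq_fintype_card (α := Fin 6), Fintype.card_fin, mul_comm]
  obtain ⟨h5, h6⟩ := h1
  unfold loops
  exact ⟨by omega, fun h => h6 (by omega)⟩

theorem sum_loops_le {f : V × Fin 6 → V × Fin 6} (hf : IsPairing f) :
    ∑ c, loops f c ≤ 3 * Nat.card V + 3 * comps f := by
  have h1 := (loops_add_loops_le hf (c := 0) (r := 1) (by decide)).1
  have h2 := (loops_add_loops_le hf (c := 0) (r := 2) (by decide)).1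
  have h3 := (loops_add_loops_le hf (c := 1) (r := 2) (by decide)).1
  rw [Fin.sum_univ_three]
  omega

/-- The total bound is half the sum of the three two-colour bounds, so equality in it saturates each
of them. -/
theorem loops_add_loops_eq {f : V × Fin 6 → V × Fin 6} (hf : IsPairing f)
    (hsum : ∑ c, loops f c = 3 * Nat.card V + 3 * comps f) {c r : Fin 3} (hcr : c ≠ r) :
    loops f c + loops f r = 2 * Nat.card V + 2 * comps f := by
  have h1 := (loops_add_loops_le hf (c := 0) (r := 1) (by decide)).1
  have h2 := (loops_add_loops_le hf (c := 0) (r := 2) (by decide)).1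
  have h3 := (loops_add_loops_le hf (c := 1) (r := 2) (by decide)).1
  rw [Fin.sum_univ_three] at hsum
  fin_cases c <;> fin_cases r <;> simp at hcr ⊢ <;> omega

/-- If lines of length one and two are absent, the lines have length at least three. -/
theorem six_mul_orbits_le {X : Type*} [Finite X] {f w : X → X} (hf : IsPairing f)
    (hw : IsPairing w) (h1 : ∀ x, f x ≠ w x) (h2 : ∀ x, f (w x) ≠ w (f x)) :
    6 * orbits f (Via w) ≤ Nat.card X := by
  classical
  have lf := Linked.contr f (Via w)
  have lw : ∀ x, Linked f (Via w) x (w x) := fun x => Linked.inner rfl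
  have f2 := hf.invol
  have w2 := hw.invol
  have f1 := hf.ne
  have w1 := hw.ne
  refine mul_card_quot_le _ 6 fun x =>
    ⟨{x, w x, f x, f (w x), w (f x), w (f (w x))}, ?_, ?_⟩
  · have a1 : x ≠ w x := (w1 x).symm
    have a2 : x ≠ f x := (f1 x).symm
    have a3 : x ≠ f (w x) := fun e => h1 x (by rw [e, f2, ← e])
    have a4 : x ≠ w (f x) := fun e => h1 x (by rw [← w2 (f x), ← e])
    have a5 : x ≠ w (f (w x)) := fun e => f1 (w x) (by rw [← w2 (f (w x)), ← e])
    have a6 : w x ≠ f x := (h1 x).symm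
    have a7 : w x ≠ f (w x) := (f1 _).symm
    have a8 : w x ≠ w (f x) := fun e => a2 (hw.injective e)
    have a9 : w x ≠ w (f (w x)) := fun e => a3 (hw.injective e)
    have a10 : f x ≠ f (w x) := fun e => a1 (hf.injective e)
    have a11 : f x ≠ w (f x) := (w1 _).symm
    have a12 : f x ≠ w (f (w x)) := fun e => h2 x (by rw [e, w2])
    have a13 : f (w x) ≠ w (f x) := h2 x
    have a14 : f (w x) ≠ w (f (w x)) := (w1 _).symm
    have a15 : w (f x) ≠ w (f (w x)) := fun e => a10 (hw.injective e)
    simp [*]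
  · intro y hy
    simp only [Finset.mem_insert, Finset.mem_singleton] at hy
    rcases hy with rfl | rfl | rfl | rfl | rfl | rfl
    · exact .refl _
    · exact lw x
    · exact lf x
    · exact (lw x).trans (lf _)
    · exact (lf x).trans (lw _)
    · exact ((lw x).trans (lf _)).trans (lw _)

/-- Contract `p` with `q`, and the former partners of `p` and `q` with each other. -/
noncomputable def tie {X : Type*} (f : X → X) (p q : X) : X → X := ex f p (f q)

theorem IsPairing.tie {X : Type*} {f : X → X} (hf : IsPairing f) (p q : X) : IsPairing (tie f p q) :=
  hf.ex p (f q)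

theorem tie_apply_left {X : Type*} {f : X → X} (hf : IsPairing f) {p q : X}
    (hpq : p ≠ q) : tie f p q p = q := by
  rw [tie, ex_apply_left hf, hf.invol]
  exact fun e => hpq (hf.injective e)

theorem tie_apply_right {X : Type*} {f : X → X} (hf : IsPairing f) {p q : X}
    (hpq : p ≠ q) : tie f p q q = p := by
  rw [(hf.tie p q).eq_comm, tie_apply_left hf hpq]

theorem tie_apply_of_ne {X : Type*} {f : X → X} (hf : IsPairing f) {p q z : X} (h1 : z ≠ p)
    (h2 : z ≠ q) (h3 : z ≠ f p) (h4 : z ≠ f q) : tie f p q z = f z :=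
  ex_apply_of_ne hf h1 h4 h3 (by rwa [hf.invol])

theorem tie_apply_contr {X : Type*} {f : X → X} (hf : IsPairing f) {p q : X} (hpq : p ≠ q) :
    tie f p q (f p) = f q := by
  rw [tie, ex_eq_ex_contr hf, hf.invol]
  exact ex_apply_left hf (by rwa [hf.invol])

/-- If a set cuts a segment from `p` to `q` out of the lines, then tying `p` to `q` splits off
this segment. -/
theorem orbits_tie {X : Type*} [Finite X] {f w : X → X} (hf : IsPairing f) (hw : IsPairing w)
    {p q : X} (S : X → Prop) (hpq : p ≠ q) (hp : S p) (hq : S q) (hwS : ∀ z, S z → S (w z))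
    (hfS : ∀ z, S z → z ≠ p → z ≠ q → S (f z)) (hfp : ¬ S (f p)) (hfq : ¬ S (f q)) :
    orbits (tie f p q) (Via w) = orbits f (Via w) + 1 := by
  refine orbits_ex_of_not_linked_ex hf hw (R := Via w) (fun _ => rfl) fun hl => hfq ?_
  refine (EqvGen.mem_iff (S := S) ?_ hl).mp hp
  have hS : ∀ z, S z → S (tie f p q z) := by
    intro z hz
    by_cases z1 : z = p
    · rw [z1, tie_apply_left hf hpq]
      exact hq
    by_cases z2 : z = q
    · rw [z2, tie_apply_right hf hpq]
      exact hp
    rw [tie_apply_of_ne hf z1 z2 (fun e => hfp (e ▸ hz)) fun e => hfq (e ▸ hz)]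
    exact hfS z hz z1 z2
  rintro x y (rfl | rfl)
  · refine ⟨hS x, fun h => ?_⟩
    have := hS _ h
    change S (tie f p q (tie f p q x)) at this
    rwa [(hf.tie p q).invol] at this
  · refine ⟨hwS x, fun h => ?_⟩
    have := hwS _ h
    rwa [hw.invol] at this

/-- A connected matching with the largest number of loops which no exchange disconnects. -/
structure IsTight (f : V × Fin 6 → V × Fin 6) : Prop where
  pairing : IsPairing f
  comps_eq : comps f = 1
  sum_eq : ∑ c, loops f c = 3 * Nat.card V + 3 * comps f
  comps_ex : ∀ h k, comps (ex f h k) ≤ 1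

/-- If every loop passed through at least six fields, each colour would have at most `V` loops,
three too few in total. -/
theorem IsTight.exists_short (hf : IsTight f) :
    (∃ c h, f h = edge c h) ∨ ∃ c h, f (edge c h) = edge c (f h) := by
  by_contra hcon
  push Not at hcon
  have h4 : Nat.card (V × Fin 6) = 6 * Nat.card V := by
    rw [Nat.card_prod, Nat.card_eq_fintype_card (α := Fin 6), Fintype.card_fin, mul_comm]
  have h5 : ∀ c, loops f c ≤ Nat.card V := fun c => by
    have := six_mul_orbits_le hf.pairing (isPairing_edge c) (hcon.1 c) (hcon.2 c)
    unfold loops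
    omega
  have h6 := hf.sum_eq
  have h7 := hf.comps_eq
  have h8 := Finset.sum_le_sum fun c (_ : c ∈ Finset.univ) => h5 c
  simp at h8
  omega

/-- The two-colour bound is already saturated and the exchange creates no component, so a gain in
one colour must be paid for in the other. -/
theorem IsTight.loops_ex (hf : IsTight f) {c r : Fin 3} (hcr : c ≠ r) {h k : V × Fin 6}
    (hc : loops (ex f h k) c = loops f c + 1) : loops (ex f h k) r + 1 ≤ loops f r := by
  have h1 := (loops_add_loops_le (hf.pairing.ex h k) hcr).1
  have h2 := loops_add_loops_eq hf.pairing hf.sum_eq hcr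
  have h3 := hf.comps_ex h k
  have h4 := hf.comps_eq
  omega

theorem IsTight.loops_tie (hf : IsTight f) {c r : Fin 3} (hcr : c ≠ r) {p q : V × Fin 6}
    (hc : loops (tie f p q) c = loops f c + 1) : loops (tie f p q) r + 1 ≤ loops f r :=
  hf.loops_ex hcr hc

/-- A loop of length one comes from a snail. -/
theorem IsTight.snail (hf : IsTight f) {c r : Fin 3} (hcr : c ≠ r) {h : V × Fin 6}
    (hh : f h = edge c h) : f (edge r (edge c h)) = edge r h := by
  obtain ⟨b, hbc, hbr⟩ := exists_third_colour c r
  by_contra hne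
  have hp := hf.pairing
  have hb : edge b (edge r h) = edge r (edge c h) := (edge_comm hcr hbc hbr h).symm
  have hr2 := (isPairing_edge (V := V) r).invol
  have hr1 := (isPairing_edge (V := V) r).ne
  have hc2 := (isPairing_edge (V := V) c).invol
  have hc1 := (isPairing_edge (V := V) c).ne
  have hb2 := (isPairing_edge (V := V) b).invol
  have hpq : edge r (edge c h) ≠ edge r h := fun e =>
    hc1 h ((isPairing_edge r).injective e)
  have hcr' : edge c h ≠ edge r h := fun e =>
    wheel_ne_wheel hcr h.2 (congrArg Prod.snd e)
  have hh' : f (edge c h) = h := by rw [← hh, hp.invol]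
  have f1 := hp.ne
  have f2 := hp.invol
  -- The propagator at `h` and the two edges of colour `r` at its ends form a segment between the
  -- tied fields.
  have g1 : loops (tie f (edge r (edge c h)) (edge r h)) r = loops f r + 1 := by
    refine orbits_tie hp (isPairing_edge r)
      (fun z => z = edge r (edge c h) ∨ z = edge r h ∨ z = h ∨ z = edge c h) hpq (by simp) (by simp)
      ?_ ?_ ?_ ?_
    · rintro z (rfl | rfl | rfl | rfl) <;> simp [hr2]
    · rintro z (rfl | rfl | rfl | rfl) <;> simp [hh, hh']
    · grind
    · grind
  -- The tied fields are the ends of an edge of the third colour, so tying also gains a loop there,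
  -- against `IsTight.loops_tie`.
  have g2 : loops (tie f (edge r (edge c h)) (edge r h)) b = loops f b + 1 := by
    refine orbits_tie hp (isPairing_edge b)
      (fun z => z = edge r (edge c h) ∨ z = edge r h) hpq (by simp) (by simp) ?_ ?_ ?_ ?_
    · rintro z (rfl | rfl)
      · rw [← hb, hb2]
        simp
      · simp [hb]
    · rintro z (rfl | rfl) <;> simp
    · grind
    · grind
  have := hf.loops_tie hbr.symm g1
  omega

section Ladder

variable {r b : Fin 3} {p q m n p' q' m' n' : V × Fin 6}

/-- Tying `p` to `p'` splits a loop of colour `r`. -/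
theorem Ladder.loops_r (L : Ladder f r b p q m n p' q' m' n') (hf : IsPairing f)
    (hne : f p ≠ p') : loops (tie f p p') r = loops f r + 1 := by
  have hd := L.ne_of_fst
  have hr2 := (isPairing_edge (V := V) r).invol
  have hr1 := (isPairing_edge (V := V) r).ne
  have f1 := hf.ne
  have f2 := hf.invol
  obtain ⟨rp, rq, bp, rp', rq', bp', fm, fn, -⟩ := L
  simp only [List.mem_cons, List.not_mem_nil, or_false, forall_eq_or_imp, forall_eq] at hd
  refine orbits_tie hf (isPairing_edge r) (fun z => z = p ∨ z = m ∨ z = m' ∨ z = p') (by grind)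
    (by simp) (by simp) ?_ ?_ ?_ ?_
  · rintro z (rfl | rfl | rfl | rfl) <;> grind
  · rintro z (rfl | rfl | rfl | rfl) <;> grind
  · grind
  · grind

/-- If `q` is contracted with `q'`, then tying `p` to `p'` splits a loop of colour `b`. -/
theorem Ladder.loops_b (L : Ladder f r b p q m n p' q' m' n') (hf : IsPairing f)
    (hne : f p ≠ p') (hq : f q = q') : loops (tie f p p') b = loops f b + 1 := by
  have hd := L.ne_of_fst
  have hr2 := (isPairing_edge (V := V) b).invol
  have hr1 := (isPairing_edge (V := V) b).ne
  have f1 := hf.ne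
  have f2 := hf.invol
  obtain ⟨rp, rq, bp, rp', rq', bp', fm, fn, -⟩ := L
  simp only [List.mem_cons, List.not_mem_nil, or_false, forall_eq_or_imp, forall_eq] at hd
  refine orbits_tie hf (isPairing_edge b) (fun z => z = p ∨ z = q ∨ z = q' ∨ z = p') (by grind)
    (by simp) (by simp) ?_ ?_ ?_ ?_
  · rintro z (rfl | rfl | rfl | rfl) <;> grind
  · rintro z (rfl | rfl | rfl | rfl) <;> grind
  · grind
  · grind

/-- If only `q` were contracted as in a melon, tying `p` to `p'` would gain a loop in both `r` and
`b`. -/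
theorem Ladder.contr_iff (L : Ladder f r b p q m n p' q' m' n') (hf : IsTight f) (hrb : r ≠ b)
    (hne : f p ≠ p') : f q ≠ q' := fun hq => by
  have h1 := L.loops_r hf.pairing hne
  have h2 := L.loops_b hf.pairing hne hq
  have := hf.loops_tie hrb h1
  omega

end Ladder

end Matching

/-! ### Loops of length two force melons. -/

section Melon

variable {V : Type*} [Finite V] {f : V × Fin 6 → V × Fin 6}
variable {r b : Fin 3} {p q m n p' q' m' n' : V × Fin 6}

theorem ne_of_sign {X : Type*} {ε : X → ℤ} (hε : IsSign ε) {x y : X} (h : ε x = -ε y) : x ≠ y := by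
  rintro rfl
  rcases hε x with e | e <;> rw [e] at h <;> norm_num at h

/-- After tying `p` to `p'` and `q` to `q'`, the former partners of `q` and `q'` are separated from
the two vertices. -/
theorem Ladder.separates (L : Ladder f r b p q m n p' q' m' n') (hf : IsTight f) (hrb : r ≠ b)
    {ε : V × Fin 6 → ℤ} (hε : IsSign ε) (hεf : Flips ε f) (hεe : ∀ c, Flips ε (edge c))
    (hshort : ∀ c h, f h ≠ edge c h) (hp : f p ≠ p') (hq : f q ≠ q') :
    ¬ Linked (tie (tie f p p') q q') SameVertex q (f q') := by
  have hd := L.ne_of_fst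
  have hr2 := (isPairing_edge (V := V) r).invol
  have hr1 := (isPairing_edge (V := V) r).ne
  have hb2 := (isPairing_edge (V := V) b).invol
  have hb1 := (isPairing_edge (V := V) b).ne
  have f1 := hf.pairing.ne
  have f2 := hf.pairing.invol
  have g1 := L.loops_r hf.pairing hp
  have g2 : loops f b ≤ loops (tie f p p') b + 1 := orbits_le_orbits_ex_add_one f _ _ _
  have hP := hf.pairing
  have hP' := hP.tie p p'
  have sb := hshort b
  have ne := @ne_of_sign _ _ hε
  have e0 : ε n' = -ε n := by rw [← L.fn, hεf]
  have e1 : ε n = -ε q := by rw [← L.rq, hεe]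
  have e2 : ε q = -ε p := by rw [← L.bp, hεe]
  have e3 : ε n' = -ε q' := by rw [← L.rq', hεe]
  have e4 : ε q' = -ε p' := by rw [← L.bp', hεe]
  have n1 : f q ≠ p' := fun e => by
    have := hεf q
    rw [e] at this
    exact ne (x := p') (y := p') (by linarith) rfl
  have n2 : f p ≠ q' := fun e => by
    have := hεf p
    rw [e] at this
    exact ne (x := q') (y := q') (by linarith) rfl
  have n3 : n ≠ p := fun e => by
    rw [← L.rq, ← hb2 p, L.bp] at e
    exact wheel_ne_wheel hrb _ (congrArg Prod.snd e)
  have n4 : n' ≠ p' := fun e => by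
    rw [← L.rq', ← hb2 p', L.bp'] at e
    exact wheel_ne_wheel hrb _ (congrArg Prod.snd e)
  have n5 : q ≠ p := L.bp ▸ hb1 p
  have n6 : q' ≠ p' := L.bp' ▸ hb1 p'
  have n7 : f p ≠ q := L.bp ▸ sb p
  have n8 : f p' ≠ q' := L.bp' ▸ sb p'
  obtain ⟨rp, rq, bp, rp', rq', bp', fm, fn, -⟩ := L
  have n9 : f p' ≠ q := fun e => n1 (by rw [← e, f2])
  have n10 : f p' ≠ n := fun e => n4 (by rw [← fn, ← e, f2])
  simp only [List.mem_cons, List.not_mem_nil, or_false, forall_eq_or_imp, forall_eq] at hd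
  have n11 : f p ≠ n := fun e => hd.1.2.2.2 (by rw [← fn, ← e, f2])
  have tp : tie f p p' p = p' := tie_apply_left hP hd.1.1
  have tp' : tie f p p' p' = p := tie_apply_right hP hd.1.1
  have tq : tie f p p' q = f q := tie_apply_of_ne hP n5 hd.2.1.1 n7.symm n9.symm
  have tq' : tie f p p' q' = f q' := tie_apply_of_ne hP hd.1.2.1.symm n6 n2.symm n8.symm
  have tn : tie f p p' n = n' := by
    rw [tie_apply_of_ne hP n3 hd.2.2.2.1 n11.symm n10.symm, fn]
  have tn' : tie f p p' n' = n := by rw [hP'.eq_comm, tn]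
  -- Both ties gain a loop of colour `r`; in colour `b` the first loses at most one and the second
  -- regains one. The two-colour bound then requires a second component.
  have g3 : loops (tie (tie f p p') q q') r = loops (tie f p p') r + 1 := by
    refine orbits_tie hP' (isPairing_edge r) (fun z => z = q ∨ z = n ∨ z = n' ∨ z = q') (by grind)
      (by simp) (by simp) ?_ ?_ ?_ ?_
    · rintro z (rfl | rfl | rfl | rfl) <;> grind
    · rintro z (rfl | rfl | rfl | rfl) <;> grind
    · grind
    · grind
  have g4 : loops (tie (tie f p p') q q') b = loops (tie f p p') b + 1 := by
    refine orbits_tie hP' (isPairing_edge b) (fun z => z = q ∨ z = p ∨ z = p' ∨ z = q') (by grind)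
      (by simp) (by simp) ?_ ?_ ?_ ?_
    · rintro z (rfl | rfl | rfl | rfl) <;> grind
    · rintro z (rfl | rfl | rfl | rfl) <;> grind
    · grind
    · grind
  have g5 := (loops_add_loops_le (hP'.tie q q') hrb).1
  have g6 := loops_add_loops_eq hP hf.sum_eq hrb
  have g7 := hf.comps_eq
  have g8 : comps (tie f p p') ≤ 1 := hf.comps_ex _ _
  intro hl
  rw [← tq'] at hl
  have g9 : comps (tie (tie f p p') q q') ≤ comps (tie f p p') := by
    exact orbits_ex_le_of_linked_ex hl
  omega

theorem ex_comm {X : Type*} (f : X → X) {h k h' k' : X} (h1 : h ≠ h') (h2 : h ≠ k') (h3 : k ≠ h')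
    (h4 : k ≠ k') : ex (ex f h k) h' k' = ex (ex f h' k') h k := by
  classical
  have : ∀ x, Equiv.swap h k (Equiv.swap h' k' x) = Equiv.swap h' k' (Equiv.swap h k x) := by
    intro x
    simp only [Equiv.swap_apply_def]
    grind
  funext x
  simp only [ex, this]

/-- The fields `p` and `p'` of a ladder are contracted with each other. -/
theorem Ladder.contr_eq (L : Ladder f r b p q m n p' q' m' n') (hf : IsTight f) {c : Fin 3}
    (hrb : r ≠ b) (hcr : c ≠ r) (hcb : c ≠ b)
    {ε : V × Fin 6 → ℤ} (hε : IsSign ε) (hεf : Flips ε f) (hεe : ∀ c, Flips ε (edge c))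
    (hshort : ∀ c h, f h ≠ edge c h) : f p = p' := by
  classical
  by_contra hp
  have hq := L.contr_iff hf hrb hp
  have hP := hf.pairing
  have s1 := L.separates hf hrb hε hεf hεe hshort hp hq
  have s2 := L.symm.separates hf hrb hε hεf hεe hshort hq hp
  have hd := L.ne_of_fst
  have f1 := hf.pairing.ne
  have f2 := hf.pairing.invol
  have ne := @ne_of_sign _ _ hε
  have e0 : ε n' = -ε n := by rw [← L.fn, hεf]
  have e1 : ε n = -ε q := by rw [← L.rq, hεe]
  have e2 : ε q = -ε p := by rw [← L.bp, hεe]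
  have e3 : ε n' = -ε q' := by rw [← L.rq', hεe]
  have e4 : ε q' = -ε p' := by rw [← L.bp', hεe]
  have n1 : f q ≠ p' := fun e => by
    have := hεf q
    rw [e] at this
    exact ne (x := p') (y := p') (by linarith) rfl
  have n2 : f p ≠ q' := fun e => by
    have := hεf p
    rw [e] at this
    exact ne (x := q') (y := q') (by linarith) rfl
  have hpq : p ≠ q := fun e => (isPairing_edge b).ne p (by rw [L.bp, e])
  have hpq' : p' ≠ q' := fun e => (isPairing_edge b).ne p' (by rw [L.bp', e])
  have hfpq : f p ≠ q := by
    rw [← L.bp]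
    exact hshort b p
  have hfpq' : f p' ≠ q' := by
    rw [← L.bp']
    exact hshort b p'
  -- the loops of colour `c` through `p`, `p'` and through `p`, `q` are different
  have c1 : ¬ Linked f (Via (edge c)) p p' := fun hl => by
    -- Tying gains a loop of colour `r`, hence must lose one of colour `c`, which is impossible for
    -- two fields on the same line.
    have g1 := hf.loops_tie hcr.symm (L.loops_r hP hp)
    have g2 : loops f c ≤ loops (tie f p p') c :=
      orbits_le_orbits_ex_of_linked (hl.trans (Linked.contr f _ p'))
    omega
  have c2 : ¬ Linked f (Via (edge c)) p q := fun hl => by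
    -- Tying the ends of an edge of colour `b` closes a loop of length one.
    have g0 : loops (tie f p q) b = loops f b + 1 := by
      have hb2 := (isPairing_edge (V := V) b).invol
      have bp := L.bp
      refine orbits_tie hP (isPairing_edge b) (fun z => z = p ∨ z = q) hpq (by simp) (by simp)
        ?_ ?_ ?_ ?_
      · rintro z (rfl | rfl) <;> grind
      · rintro z (rfl | rfl) <;> simp
      · grind
      · grind
    have g1 := hf.loops_tie hcb.symm g0
    have g2 : loops f c ≤ loops (tie f p q) c :=
      orbits_le_orbits_ex_of_linked (hl.trans (Linked.contr f _ q))
    omega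
  simp only [List.mem_cons, List.not_mem_nil, or_false, forall_eq_or_imp, forall_eq] at hd
  have tq' : tie f p p' q' = f q' := tie_apply_of_ne hP (by grind) (by grind) (by grind) (by grind)
  have tq : tie f p p' q = f q := tie_apply_of_ne hP (by grind) (by grind) (by grind) (by grind)
  have tp' : tie f q q' p' = f p' := tie_apply_of_ne hP (by grind) (by grind) (by grind) (by grind)
  have tp : tie f q q' p = f p := tie_apply_of_ne hP (by grind) (by grind) (by grind) (by grind)
  set g := tie (tie f p p') q q' with hg
  have hgP : IsPairing g := (hP.tie _ _).tie _ _
  -- The two ties commute, so the separation obtained from the symmetric ladder concerns the same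
  -- matching `g`.
  have hcomm : tie (tie f q q') p p' = g := by
    rw [hg, tie, tp', tie, tie, tq', tie]
    exact ex_comm f (by grind) (by grind) (by grind) (by grind)
  rw [hcomm] at s2
  have gq : g q = q' := tie_apply_left (hP.tie _ _) (by grind)
  have gfq : g (f q) = f q' := by
    rw [hg, ← tq, ← tq']
    exact tie_apply_contr (hP.tie _ _) hd.2.1.2.1
  have gfp : g (f p) = f p' := by
    rw [← hcomm, ← tp, ← tp']
    exact tie_apply_contr (hP.tie _ _) hd.1.1
  have gz : ∀ z, z ≠ p → z ≠ p' → z ≠ q → z ≠ q' → z ≠ f p → z ≠ f p' → z ≠ f q → z ≠ f q' →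
      g z = f z := by
    intro z z1 z2 z3 z4 z5 z6 z7 z8
    rw [hg, tie_apply_of_ne (hP.tie _ _) z3 z4 (by rwa [tq]) (by rwa [tq'])]
    exact tie_apply_of_ne hP z1 z2 z5 z6
  have lpq : Linked g SameVertex p q := Linked.inner (by rw [← L.bp]; rfl)
  -- Follow the line of colour `c` through `p` inside the component of the two vertices. It can
  -- cross to the rest only at `p`, `p'`, `q` or `q'`; `p'` and `q` are excluded by `c1` and `c2`,
  -- and `q'` has the same sign as `p`, so the signs cannot cancel.
  have hsum := sum_mem_eq_zero hP (isPairing_edge c) (ε := ε)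
    (fun z => Linked f (Via (edge c)) p z ∧ Linked g SameVertex p z) p q' (by grind) ?_ (hεe c)
    ?_ fun z _ _ _ => hεf z
  · rw [if_pos ⟨.refl p, .refl p⟩] at hsum
    have := hε p
    split_ifs at hsum <;> omega
  · rintro z ⟨h1, h2⟩
    exact ⟨h1.trans (Linked.inner rfl), h2.trans (Linked.inner rfl)⟩
  · rintro z ⟨h1, h2⟩ z1 z2
    refine ⟨⟨h1.trans (Linked.contr f _ z), ?_⟩, ?_, ?_⟩
    · have := gz z z1 (fun e => c1 (e ▸ h1)) (fun e => c2 (e ▸ h1)) z2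
        (fun e => s2 ((e ▸ h2).trans (gfp ▸ Linked.contr g _ (f p))))
        (fun e => s2 (e ▸ h2))
        (fun e => s1 ((lpq.symm.trans (e ▸ h2)).trans (gfq ▸ Linked.contr g _ (f q))))
        (fun e => s1 (lpq.symm.trans (e ▸ h2)))
      rw [← this]
      exact h2.trans (Linked.contr g _ z)
    · intro e
      refine s2 ?_
      rw [hP.eq_comm] at e
      exact (e ▸ h2 : Linked g SameVertex p (f p)).trans (gfp ▸ Linked.contr g _ (f p))
    · intro e
      rw [hP.eq_comm] at e
      exact s1 (lpq.symm.trans (e ▸ h2))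

/-- Equality for colours 0 and 1 makes their graph bipartite; an edge of colour 2 joins the ends of
a path of three such edges, so it flips the sign as well. -/
theorem IsTight.exists_sign (hf : IsTight f) :
    ∃ ε, IsSign ε ∧ Flips ε f ∧ ∀ c, Flips ε (edge c) := by
  obtain ⟨ε, h1, h2, h3, h4⟩ := (loops_add_loops_le hf.pairing (c := 0) (r := 1) (by decide)).2
    (loops_add_loops_eq hf.pairing hf.sum_eq (by decide))
  refine ⟨ε, h1, h2, fun c => ?_⟩
  fin_cases c
  · exact h3
  · exact h4
  · intro x
    have := edge_comm (c := 0) (r := 1) (b := 2) (by decide) (by decide) (by decide) (edge 1 x)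
    rw [(isPairing_edge 1).invol] at this
    change ε (edge 2 x) = _
    rw [← this, h4, h3, h4, neg_neg]

/-- In the absence of loops of length one, a loop of length two comes from a melon. -/
theorem IsTight.melon (hf : IsTight f) (hshort : ∀ c h, f h ≠ edge c h) {c : Fin 3}
    {h : V × Fin 6} (hh : f (edge c h) = edge c (f h)) :
    h.1 ≠ (f h).1 ∧ ∀ r, c ≠ r → f (edge r h) = edge r (f h) ∧
      f (edge r (edge c h)) = edge r (edge c (f h)) := by
  obtain ⟨ε, hε, hεf, hεe⟩ := hf.exists_sign
  -- A propagator within one vertex would join fields of opposite sign, hence the ends of an edge,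
  -- giving a loop of length one.
  have hne : h.1 ≠ (f h).1 := by
    intro e
    obtain ⟨d, hd⟩ := exists_edge_eq hε hεe e (by rw [hεf, neg_neg])
    exact hshort d h hd.symm
  refine ⟨hne, fun r hcr => ?_⟩
  obtain ⟨b, hbc, hbr⟩ := exists_third_colour c r
  have L : Ladder f r b (edge r (edge c h)) (edge r h) (edge c h) h
      (edge r (edge c (f h))) (edge r (f h)) (edge c (f h)) (f h) := by
    have hr2 := (isPairing_edge (V := V) r).invol
    have hb2 := (isPairing_edge (V := V) b).invol
    exact
      { rp := hr2 _
        rq := hr2 _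
        bp := by rw [edge_comm hcr hbc hbr, hb2]
        rp' := hr2 _
        rq' := hr2 _
        bp' := by rw [edge_comm hcr hbc hbr, hb2]
        fm := hh
        fn := rfl
        ne := hne }
  exact ⟨L.symm.contr_eq hf hbr.symm hcr hbc.symm hε hεf hεe hshort,
    L.contr_eq hf hbr.symm hcr hbc.symm hε hεf hεe hshort⟩

end Melon

/-! ### Line counts under bijections, sums and invariants. -/

section Transport

variable {X Y : Type*}

theorem orbits_congr {f : X → X} {f' : Y → Y} {R : X → X → Prop} {R' : Y → Y → Prop} (φ : X ≃ Y)
    (hf : ∀ x, f' (φ x) = φ (f x)) (hR : ∀ x y, R x y ↔ R' (φ x) (φ y)) :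
    orbits f R = orbits f' R' := by
  refine Nat.card_congr (Quot.congr φ fun x y => ?_)
  simp only [Step, hf, hR x y, φ.injective.eq_iff]

theorem orbits_sum [Finite X] [Finite Y] (f : X → X) (g : Y → Y) (R : X → X → Prop)
    (S : Y → Y → Prop) :
    orbits (Sum.map f g) (Sum.LiftRel R S) = orbits f R + orbits g S := by
  unfold orbits
  rw [← Nat.card_sum]
  refine Nat.card_congr
    { toFun := Quot.lift (Sum.map (Quot.mk _) (Quot.mk _)) ?_
      invFun := Sum.elim (Quot.lift (fun x => Quot.mk _ (.inl x)) ?_)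
        (Quot.lift (fun y => Quot.mk _ (.inr y)) ?_)
      left_inv := ?_
      right_inv := ?_ }
  · rintro x y (rfl | h)
    · rcases x with x | x
      · exact congrArg Sum.inl (Quot.sound (Or.inl rfl))
      · exact congrArg Sum.inr (Quot.sound (Or.inl rfl))
    · rcases h with h | h
      · exact congrArg Sum.inl (Quot.sound (Or.inr h))
      · exact congrArg Sum.inr (Quot.sound (Or.inr h))
  · rintro x y (rfl | h)
    · exact Quot.sound (Or.inl rfl)
    · exact Quot.sound (Or.inr (.inl h))
  · rintro x y (rfl | h)
    · exact Quot.sound (Or.inl rfl)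
    · exact Quot.sound (Or.inr (.inr h))
  · rintro ⟨x | x⟩ <;> rfl
  · rintro (q | q) <;> induction q using Quot.ind <;> rfl

/-- An invariant with `m` values shows that there are at least `m` lines. -/
theorem le_orbits [Finite X] {f : X → X} {R : X → X → Prop} {m : ℕ} (I : X → Fin m)
    (hI : Function.Surjective I) (hf : ∀ x, I (f x) = I x) (hR : ∀ x y, R x y → I y = I x) :
    m ≤ orbits f R := by
  have := Nat.card_le_card_of_surjective (Quot.lift (r := Step f R) I ?_) ?_
  · rwa [Nat.card_eq_fintype_card (α := Fin m), Fintype.card_fin] at this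
  · rintro x y (rfl | h)
    · exact (hf x).symm
    · exact (hR x y h).symm
  · intro i
    obtain ⟨x, hx⟩ := hI i
    exact ⟨Quot.mk _ x, hx⟩

theorem orbits_pos [Finite X] (f : X → X) (R : X → X → Prop) [Nonempty X] : 0 < orbits f R := by
  have : Nonempty (Quot (Step f R)) := ⟨Quot.mk _ (Classical.arbitrary X)⟩
  exact Nat.card_pos

theorem orbits_of_isEmpty (f : X → X) (R : X → X → Prop) [IsEmpty X] : orbits f R = 0 := by
  have : IsEmpty (Quot (Step f R)) := ⟨fun q => q.ind (β := fun _ => False) isEmptyElim⟩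
  exact Nat.card_of_isEmpty

theorem linked_of_orbits_le_one [Finite X] {f : X → X} {R : X → X → Prop} (h : orbits f R ≤ 1)
    (x y : X) : Linked f R x y := by
  have := (Finite.card_le_one_iff_subsingleton (α := Quot (Step f R))).mp h
  exact Quot.eqvGen_exact (Subsingleton.elim _ _)

theorem orbits_le_one [Finite X] {f : X → X} {R : X → X → Prop}
    (h : ∀ x y, Linked f R x y) : orbits f R ≤ 1 := by
  refine (Finite.card_le_one_iff_subsingleton (α := Quot (Step f R))).mpr ⟨?_⟩
  rintro ⟨x⟩ ⟨y⟩
  exact Quot.eqvGen_sound (h x y)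

end Transport

/-! ### Loop counts and optimality of diagrams and their joins. -/

namespace Diagram

attribute [instance] Diagram.finite

theorem isPairing (D : Diagram) : IsPairing D.contr := ⟨D.contr_contr, D.contr_ne⟩

theorem numLoopsOfColour_eq (D : Diagram) (c : Fin 3) :
    D.numLoopsOfColour c = D.rings + loops D.contr c := rfl

theorem numLoops_eq (D : Diagram) : D.numLoops = 3 * D.rings + ∑ c, loops D.contr c := by
  simp only [numLoops, numLoopsOfColour_eq, Finset.sum_add_distrib]
  simp

theorem numComponents_eq (D : Diagram) : D.numComponents = D.rings + comps D.contr := by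
  refine congrArg (D.rings + ·) (Nat.card_congr
    { toFun := Quot.lift (fun v => Quot.mk _ (v, 0)) ?_
      invFun := Quot.lift (fun x => Quot.mk _ x.1) ?_
      left_inv := ?_
      right_inv := ?_ })
  · rintro v w ⟨i, j, h⟩
    refine Quot.eqvGen_sound ?_
    have h1 : Linked D.contr SameVertex (v, 0) (v, i) := Linked.inner rfl
    have h2 : Linked D.contr SameVertex (v, i) (w, j) := h ▸ Linked.contr D.contr _ (v, i)
    have h3 : Linked D.contr SameVertex (w, j) (w, 0) := Linked.inner rfl
    exact (h1.trans h2).trans h3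
  · rintro x y (rfl | h)
    · exact Quot.sound ⟨x.2, (D.contr x).2, rfl⟩
    · exact congrArg (Quot.mk _) h
  · rintro ⟨v⟩
    rfl
  · rintro ⟨x⟩
    exact Quot.sound (Or.inr rfl)

theorem numLoops_le (D : Diagram) : D.numLoops ≤ 3 * D.numVertices + 3 * D.numComponents := by
  have := sum_loops_le D.isPairing
  rw [numLoops_eq, numComponents_eq, numVertices]
  omega

/-- A connected diagram whose number of loops attains the general bound. -/
def IsOptimal (D : Diagram) : Prop :=
  D.numComponents = 1 ∧ D.numLoops = 3 * D.numVertices + 3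

/-! ### Isomorphisms -/

/-- The map of fields which belongs to a renaming of the vertices and a relabelling of fields. -/
def fieldMap {V W : Type*} (e : V ≃ W) (g : V → Equiv.Perm (Fin 6)) : V × Fin 6 ≃ W × Fin 6 where
  toFun x := (e x.1, g x.1 x.2)
  invFun y := (e.symm y.1, (g (e.symm y.1)).symm y.2)
  left_inv x := by simp
  right_inv y := by simp

/-- An isomorphism given by a renaming of the vertices and a relabelling of the fields. -/
structure IsoVia (D D' : Diagram) (e : D.V ≃ D'.V) (g : D.V → Equiv.Perm (Fin 6)) : Prop where
  rings : D.rings = D'.rings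
  aut : ∀ v, IsAutomorphism (g v)
  contr : ∀ x, D'.contr (fieldMap e g x) = fieldMap e g (D.contr x)

theorem isAutomorphism_one : IsAutomorphism 1 := fun _ _ => rfl

variable {D D' : Diagram} {e : D.V ≃ D'.V} {g : D.V → Equiv.Perm (Fin 6)}

theorem IsoVia.iso (h : IsoVia D D' e g) : D.Iso D' := by
  refine ⟨h.rings, e, g, h.aut, fun v i w j hvi => ?_⟩
  have := h.contr (v, i)
  rw [hvi] at this
  exact this

theorem Iso.exists_isoVia (h : D.Iso D') : ∃ e g, IsoVia D D' e g := by
  obtain ⟨h1, e, g, h2, h3⟩ := h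
  exact ⟨e, g, h1, h2, fun x => h3 x.1 x.2 _ _ rfl⟩

theorem IsoVia.edge (h : IsoVia D D' e g) (c : Fin 3) (x : D.V × Fin 6) :
    edge c (fieldMap e g x) = fieldMap e g (edge c x) := Prod.ext rfl (h.aut x.1 c x.2)

theorem IsoVia.loops (h : IsoVia D D' e g) (c : Fin 3) : loops D.contr c = loops D'.contr c :=
  orbits_congr (fieldMap e g) h.contr fun x y => by
    rw [Via, Via, h.edge, (fieldMap e g).injective.eq_iff]

theorem IsoVia.comps (h : IsoVia D D' e g) : comps D.contr = comps D'.contr :=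
  orbits_congr (fieldMap e g) h.contr fun _ _ => (e.injective.eq_iff).symm

theorem IsoVia.isOptimal (h : IsoVia D D' e g) (hD : D.IsOptimal) : D'.IsOptimal := by
  unfold IsOptimal at *
  rw [numComponents_eq, numLoops_eq, numVertices] at *
  rw [← h.comps, ← h.rings, ← Nat.card_congr e]
  simp only [← h.loops]
  exact hD

theorem IsoVia.isMelonic (h : IsoVia D D' e g) (hD : D.IsMelonic) : D'.IsMelonic :=
  .iso D D' hD h.iso

/-! ### Disjoint unions and exchanges -/

theorem exchange_contr (D : Diagram) (h k : D.V × Fin 6) :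
    (D.exchange h k).contr = ex D.contr h k := by
  refine funext fun (x : D.V × Fin 6) => ?_
  simp only [exchange, ex]
  congr!

/-- A field of the first part of a disjoint union. -/
def inlField {V W : Type*} (x : V × Fin 6) : (V ⊕ W) × Fin 6 := (.inl x.1, x.2)

/-- A field of the second part of a disjoint union. -/
def inrField {V W : Type*} (x : W × Fin 6) : (V ⊕ W) × Fin 6 := (.inr x.1, x.2)

theorem inlField_injective {V W : Type*} :
    Function.Injective (inlField : V × Fin 6 → (V ⊕ W) × Fin 6) := fun x y h => by
  simpa [inlField, Prod.ext_iff] using h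

theorem inrField_injective {V W : Type*} :
    Function.Injective (inrField : W × Fin 6 → (V ⊕ W) × Fin 6) := fun x y h => by
  simpa [inrField, Prod.ext_iff] using h

theorem inlField_ne_inrField {V W : Type*} (x : V × Fin 6) (y : W × Fin 6) :
    (inlField x : (V ⊕ W) × Fin 6) ≠ inrField y := fun h => Sum.inl_ne_inr (congrArg Prod.fst h)

theorem disjointUnion_contr_inl (D E : Diagram) (x : D.V × Fin 6) :
    (D.disjointUnion E).contr (inlField x) = inlField (D.contr x) := rfl

theorem disjointUnion_contr_inr (D E : Diagram) (x : E.V × Fin 6) :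
    (D.disjointUnion E).contr (inrField x) = inrField (E.contr x) := rfl

theorem orbits_disjointUnion (D E : Diagram) (R : D.V × Fin 6 → D.V × Fin 6 → Prop)
    (S : E.V × Fin 6 → E.V × Fin 6 → Prop)
    (T : (D.V ⊕ E.V) × Fin 6 → (D.V ⊕ E.V) × Fin 6 → Prop)
    (hR : ∀ x y, T (inlField x) (inlField y) ↔ R x y)
    (hS : ∀ x y, T (inrField x) (inrField y) ↔ S x y)
    (hRS : ∀ x y, ¬ T (inlField x) (inrField y) ∧ ¬ T (inrField y) (inlField x)) :
    orbits (D.disjointUnion E).contr T = orbits D.contr R + orbits E.contr S := by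
  rw [← orbits_sum]
  refine orbits_congr (Equiv.sumProdDistrib D.V E.V (Fin 6)) ?_ ?_
  · rintro ⟨v | v, i⟩ <;> rfl
  · rintro ⟨v | v, i⟩ ⟨w | w, j⟩
    · exact (hR (v, i) (w, j)).trans Sum.liftRel_inl_inl.symm
    · exact iff_of_false (hRS (v, i) (w, j)).1 Sum.not_liftRel_inl_inr
    · exact iff_of_false (hRS (w, j) (v, i)).2 Sum.not_liftRel_inr_inl
    · exact (hS (v, i) (w, j)).trans Sum.liftRel_inr_inr.symm

theorem loops_disjointUnion (D E : Diagram) (c : Fin 3) :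
    loops (D.disjointUnion E).contr c = loops D.contr c + loops E.contr c := by
  refine orbits_disjointUnion D E _ _ _ ?_ ?_ ?_
  · exact fun x y => inlField_injective.eq_iff (a := y) (b := edge c x)
  · exact fun x y => inrField_injective.eq_iff (a := y) (b := edge c x)
  · exact fun x y => ⟨(inlField_ne_inrField (edge c x) y).symm, inlField_ne_inrField x (edge c y)⟩

theorem comps_disjointUnion (D E : Diagram) :
    comps (D.disjointUnion E).contr = comps D.contr + comps E.contr := by
  refine orbits_disjointUnion D E _ _ _ ?_ ?_ ?_
  · exact fun x y => Sum.inl_injective.eq_iff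
  · exact fun x y => Sum.inr_injective.eq_iff
  · exact fun x y => ⟨Sum.inl_ne_inr, Sum.inr_ne_inl⟩

/-- Cut the propagators at `h` and `k` and join the two diagrams there. -/
noncomputable def join (D E : Diagram) (h : D.V × Fin 6) (k : E.V × Fin 6) : Diagram :=
  (D.disjointUnion E).exchange (inlField h) (inrField k)

theorem replacePropagator_eq (D : Diagram) (E : TwoPoint) (h : D.V × Fin 6) :
    D.replacePropagator h E = D.join E.toDiagram h E.cut := rfl

theorem not_linked_disjointUnion (D E : Diagram) (h : D.V × Fin 6) (k : E.V × Fin 6) :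
    ¬ Linked (D.disjointUnion E).contr SameVertex (inlField h) (inrField k) := by
  intro hl
  refine Bool.noConfusion ((EqvGen.mem_iff (S := fun x => x.1.isLeft = true) ?_ hl).mp rfl)
  rintro ⟨v | v, i⟩ ⟨w | w, j⟩ (h | h)
  all_goals first
    | exact Iff.rfl
    | exact (Sum.inr_ne_inl (congrArg Prod.fst h)).elim
    | exact (Sum.inl_ne_inr (congrArg Prod.fst h)).elim
    | exact (Sum.inl_ne_inr h).elim
    | exact (Sum.inr_ne_inl h).elim

theorem join_contr (D E : Diagram) (h : D.V × Fin 6) (k : E.V × Fin 6) :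
    (D.join E h k).contr = ex (D.disjointUnion E).contr (inlField h) (inrField k) :=
  exchange_contr _ _ _

theorem comps_join (D E : Diagram) (h : D.V × Fin 6) (k : E.V × Fin 6) :
    comps (D.join E h k).contr + 1 = comps D.contr + comps E.contr := by
  rw [← comps_disjointUnion, join_contr]
  exact orbits_ex_of_not_linked (D.disjointUnion E).isPairing (isPairing_edge 0) (R := SameVertex)
    (fun _ => rfl) (not_linked_disjointUnion D E h k)

theorem loops_join (D E : Diagram) (h : D.V × Fin 6) (k : E.V × Fin 6) (c : Fin 3) :
    loops (D.join E h k).contr c + 1 = loops D.contr c + loops E.contr c := by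
  rw [← loops_disjointUnion, join_contr]
  exact orbits_ex_of_not_linked (D.disjointUnion E).isPairing (isPairing_edge c)
    (R := Via (edge c)) (fun _ => rfl) fun hl => not_linked_disjointUnion D E h k (linked_sameVertex_of_linked hl)

theorem numVertices_join (D E : Diagram) (h : D.V × Fin 6) (k : E.V × Fin 6) :
    (D.join E h k).numVertices = D.numVertices + E.numVertices :=
  Nat.card_sum

theorem numComponents_join (D E : Diagram) (h : D.V × Fin 6) (k : E.V × Fin 6) :
    (D.join E h k).numComponents + 1 = D.numComponents + E.numComponents := by
  have := comps_join D E h k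
  simp only [numComponents_eq]
  have hr : (D.join E h k).rings = D.rings + E.rings := rfl
  omega

theorem numLoops_join (D E : Diagram) (h : D.V × Fin 6) (k : E.V × Fin 6) :
    (D.join E h k).numLoops + 3 = D.numLoops + E.numLoops := by
  have := loops_join D E h k
  have h0 := this 0
  have h1 := this 1
  have h2 := this 2
  simp only [numLoops_eq, Fin.sum_univ_three]
  have hr : (D.join E h k).rings = D.rings + E.rings := rfl
  omega

/-- A join loses three loops in all, exactly the second constant 3 in the sum of the two bounds. -/
theorem isOptimal_join (D E : Diagram) (h : D.V × Fin 6) (k : E.V × Fin 6) (hD : D.IsOptimal)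
    (hE : E.IsOptimal) : (D.join E h k).IsOptimal := by
  have h1 := numComponents_join D E h k
  have h2 := numLoops_join D E h k
  have h3 := numVertices_join D E h k
  obtain ⟨h4, h5⟩ := hD
  obtain ⟨h6, h7⟩ := hE
  exact ⟨by omega, by omega⟩

theorem isEmpty_of_rings_pos {D : Diagram} (hD : D.numComponents = 1) (hr : 0 < D.rings) :
    IsEmpty D.V ∧ D.rings = 1 := by
  rw [numComponents_eq] at hD
  refine ⟨?_, by omega⟩
  rw [← not_nonempty_iff]
  rintro ⟨v⟩
  have : Nonempty (D.V × Fin 6) := ⟨(v, 0)⟩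
  have := orbits_pos D.contr SameVertex
  unfold comps at hD
  omega

theorem isOptimal_replaceRing (D : Diagram) (E : TwoPoint) (hD : D.IsOptimal) (hr : 0 < D.rings)
    (hE : E.toDiagram.IsOptimal) : (D.replaceRing E).IsOptimal := by
  obtain ⟨h1, h2⟩ := isEmpty_of_rings_pos hD.1 hr
  have h3 : (D.replaceRing E).rings = E.rings := by
    change D.rings - 1 + E.rings = _
    omega
  have h4 : (D.replaceRing E).numVertices = E.numVertices := by
    refine (Nat.card_sum (α := D.V) (β := E.V)).trans ?_
    simp [numVertices]
  have h5 : comps (D.replaceRing E).contr = comps E.contr := by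
    refine (comps_disjointUnion D E.toDiagram).trans ?_
    rw [comps, orbits_of_isEmpty, zero_add]
  have h6 : ∀ c, loops (D.replaceRing E).contr c = loops E.contr c := by
    intro c
    refine (loops_disjointUnion D E.toDiagram c).trans ?_
    rw [loops, orbits_of_isEmpty, zero_add]
  unfold IsOptimal at hE ⊢
  rw [numComponents_eq, numLoops_eq, h3, h4, h5] at *
  simp only [h6]
  exact hE

end Diagram

/-! ### Symmetries of the wheel and of the elementary diagrams. -/

/-- The automorphism of the wheel which takes the field `0` to `a`. -/
def autFun (a : Fin 6) : Fin 6 → Fin 6 :=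
  ![a, wheel 1 a, wheel 0 (wheel 1 a), wheel 2 a, wheel 2 (wheel 1 a), wheel 0 a]

/-- The automorphism group of the wheel acts transitively on the fields. -/
theorem exists_automorphism (i j : Fin 6) : ∃ g, IsAutomorphism g ∧ g i = j := by
  have h1 : ∀ a, Function.Injective (autFun a) := by unfold Function.Injective; decide
  have h2 : ∀ a c i, wheel c (autFun a i) = autFun a (wheel c i) := by decide
  have h3 : ∀ i j, ∃ a, autFun a i = j := by decide
  obtain ⟨a, ha⟩ := h3 i j
  exact ⟨Equiv.ofBijective _ (Finite.injective_iff_bijective.mp (h1 a)), h2 a, ha⟩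

/-- The contraction of the closed snail. -/
def snailPairing : Fin 6 → Fin 6 := ![1, 0, 5, 4, 3, 2]

/-- For each field a symmetry of the closed snail which takes the field `0` to that field. -/
def snailSymm : Fin 6 → Fin 6 → Fin 6 :=
  ![![0, 1, 2, 3, 4, 5], ![1, 0, 3, 2, 5, 4], ![2, 5, 0, 3, 4, 1], ![3, 4, 1, 2, 5, 0],
    ![4, 3, 0, 5, 2, 1], ![5, 2, 1, 4, 3, 0]]

/-- All fields of the closed snail are equivalent. -/
theorem exists_snail_symm (j : Fin 6) : ∃ g : Equiv.Perm (Fin 6), IsColourPermutation g ∧ g 0 = j ∧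
    ∀ i, snailPairing (g i) = g (snailPairing i) := by
  have h1 : ∀ a, Function.Injective (snailSymm a) := by unfold Function.Injective; decide
  have h2 : ∀ a, ∃ π : Equiv.Perm (Fin 3), ∀ c i,
      wheel (π c) (snailSymm a i) = snailSymm a (wheel c i) := by decide
  have h3 : ∀ a, snailSymm a 0 = a := by decide
  have h4 : ∀ a i, snailPairing (snailSymm a i) = snailSymm a (snailPairing i) := by decide
  exact ⟨Equiv.ofBijective _ (Finite.injective_iff_bijective.mp (h1 j)), h2 j, h3 j, h4 j⟩

theorem IsAutomorphism.isColourPermutation {g : Equiv.Perm (Fin 6)} (h : IsAutomorphism g) :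
    IsColourPermutation g := ⟨1, h⟩

theorem IsColourPermutation.mul {g g' : Equiv.Perm (Fin 6)} (h : IsColourPermutation g)
    (h' : IsColourPermutation g') : IsColourPermutation (g * g') := by
  obtain ⟨π, h⟩ := h
  obtain ⟨π', h'⟩ := h'
  refine ⟨π * π', fun c i => ?_⟩
  simp only [Equiv.Perm.mul_apply, h, h']

/-- Cut a two-point diagram at another field. -/
def TwoPoint.withCut (E : TwoPoint) (k : E.V × Fin 6) : TwoPoint := { E with cut := k }

theorem TwoPoint.mk_congr {V : Type} {f₁ f₂ : Finite V} {c₁ c₂ : V × Fin 6 → V × Fin 6}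
    {p₁ p₂ q₁ q₂} {n : ℕ} {k₁ k₂ : V × Fin 6} (hc : c₁ = c₂) (hk : k₁ = k₂) :
    (⟨⟨V, f₁, c₁, p₁, q₁, n⟩, k₁⟩ : TwoPoint) = ⟨⟨V, f₂, c₂, p₂, q₂, n⟩, k₂⟩ := by
  subst hc hk
  rfl

theorem Diagram.mk_congr {V : Type} {f₁ f₂ : Finite V} {c₁ c₂ : V × Fin 6 → V × Fin 6}
    {p₁ p₂ q₁ q₂} {n : ℕ} (hc : c₁ = c₂) :
    (⟨V, f₁, c₁, p₁, q₁, n⟩ : Diagram) = ⟨V, f₂, c₂, p₂, q₂, n⟩ := by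
  subst hc
  rfl

/-- An elementary two-point diagram may be cut at any other propagator. -/
theorem IsElementary.withCut {E : TwoPoint} (hE : IsElementary E) (k : E.V × Fin 6) :
    IsElementary (E.withCut k) ∨ IsElementary (E.withCut (E.contr k)) := by
  obtain ⟨g, hg, rfl | rfl⟩ := hE
  · obtain ⟨s, hs, h0, hs'⟩ := exists_snail_symm (g.symm k.2)
    left
    refine ⟨g * s, hg.mul hs, Or.inl (TwoPoint.mk_congr (funext fun x => ?_) ?_)⟩
    · refine Prod.ext rfl ?_
      change g (snailPairing (g.symm x.2)) = g (s (snailPairing (s.symm (g.symm x.2))))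
      rw [← hs', Equiv.apply_symm_apply]
    · refine Prod.ext rfl ?_
      change k.2 = g (s 0)
      rw [h0, Equiv.apply_symm_apply]
  -- The closed melon is invariant under any common permutation of fields, but the prescribed cut
  -- lies on the vertex `false`; a cut on the other vertex is replaced by its partner.
  · obtain ⟨s, hs, h0⟩ := exists_automorphism 0 (g.symm k.2)
    have key : ∀ k' : Bool × Fin 6, k'.1 = false → k'.2 = k.2 →
        IsElementary ((elementaryMelon.recolour g).withCut k') := by
      rintro ⟨b, i⟩ rfl h2
      refine ⟨g * s, hg.mul hs.isColourPermutation, Or.inr (TwoPoint.mk_congr (funext fun x => ?_)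
        (Prod.ext rfl ?_))⟩
      · refine Prod.ext rfl ?_
        change g (g.symm x.2) = (g * s) ((g * s).symm x.2)
        rw [Equiv.apply_symm_apply, Equiv.apply_symm_apply]
      · change i = g (s 0)
        rw [h0, Equiv.apply_symm_apply]
        exact h2
    obtain ⟨b, i⟩ := k
    cases b
    · exact Or.inl (key _ rfl rfl)
    · refine Or.inr (key _ rfl ?_)
      exact g.apply_symm_apply i

namespace Diagram

/-! ### Elementary diagrams are optimal -/

theorem loops_recolour (E : TwoPoint) {g : Equiv.Perm (Fin 6)} {π : Equiv.Perm (Fin 3)}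
    (hg : ∀ c i, wheel (π c) (g i) = g (wheel c i)) (c : Fin 3) :
    loops (E.recolour g).contr (π c) = loops E.contr c := by
  symm
  refine orbits_congr ((Equiv.refl E.V).prodCongr g) ?_ ?_
  · rintro ⟨v, i⟩
    change Prod.map id g (E.contr (v, g.symm (g i))) = _
    rw [Equiv.symm_apply_apply]
    rfl
  · rintro ⟨v, i⟩ ⟨w, j⟩
    change (w, j) = (v, wheel c i) ↔ ((w, g j) : E.V × Fin 6) = (v, wheel (π c) (g i))
    rw [hg, Prod.mk.injEq, Prod.mk.injEq, g.injective.eq_iff]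

theorem comps_recolour (E : TwoPoint) (g : Equiv.Perm (Fin 6)) :
    comps (E.recolour g).contr = comps E.contr := by
  symm
  refine orbits_congr ((Equiv.refl E.V).prodCongr g) ?_ ?_
  · rintro ⟨v, i⟩
    change Prod.map id g (E.contr (v, g.symm (g i))) = _
    rw [Equiv.symm_apply_apply]
    rfl
  · exact fun x y => Iff.rfl

theorem isOptimal_recolour {E : TwoPoint} {g : Equiv.Perm (Fin 6)} (hg : IsColourPermutation g)
    (hE : E.IsOptimal) : (E.recolour g).IsOptimal := by
  obtain ⟨π, hg⟩ := hg
  unfold IsOptimal at *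
  rw [numComponents_eq, numLoops_eq] at *
  rw [comps_recolour, ← Equiv.sum_comp π]
  simp only [loops_recolour E hg]
  exact hE

theorem isOptimal_of_le (D : Diagram) (hr : D.rings = 0) (hc : comps D.contr = 1)
    (h : 3 * D.numVertices + 3 ≤ ∑ c, loops D.contr c) : D.IsOptimal := by
  have h1 : D.numComponents = 1 := by
    rw [numComponents_eq]
    omega
  have h2 := D.numLoops_le
  refine ⟨h1, ?_⟩
  rw [numLoops_eq] at *
  omega

theorem isOptimal_elementarySnail : elementarySnail.IsOptimal := by
  have : Nonempty (elementarySnail.V × Fin 6) := ⟨((), 0)⟩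
  refine isOptimal_of_le _ rfl (le_antisymm (orbits_le_one fun x y => Linked.inner rfl)
    (orbits_pos _ _)) ?_
  -- Row `c` numbers the loops of colour `c` in the closed snail; the numbering is constant along
  -- propagators and edges.
  let I : Fin 3 → Fin 6 → Fin 2 := ![![0, 0, 0, 1, 1, 0], ![0, 0, 1, 1, 1, 1], ![0, 0, 1, 0, 0, 1]]
  have h1 : ∀ c, Function.Surjective (I c) := by unfold Function.Surjective; decide
  have h2 : ∀ c i, I c (snailPairing i) = I c i := by decide
  have h3 : ∀ c i, I c (wheel c i) = I c i := by decide
  have h4 : ∀ c, 2 ≤ loops elementarySnail.contr c := fun c =>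
    le_orbits (fun x : elementarySnail.V × Fin 6 => I c x.2)
      (fun j => (h1 c j).imp' (fun i => ((), i)) fun _ h => h) (fun x => h2 c x.2) (by
        rintro x y rfl
        exact h3 c x.2)
  have h5 : elementarySnail.numVertices = 1 := Nat.card_unique (α := Unit)
  have := Finset.sum_le_sum fun c (_ : c ∈ Finset.univ) => h4 c
  rw [h5]
  simpa using this

theorem isOptimal_elementaryMelon : elementaryMelon.IsOptimal := by
  have : Nonempty (elementaryMelon.V × Fin 6) := ⟨(true, 0)⟩
  have hc : ∀ x : elementaryMelon.V × Fin 6,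
      Linked elementaryMelon.contr SameVertex x (true, 0) := by
    rintro ⟨b, i⟩
    cases b
    · exact (Linked.contr elementaryMelon.contr SameVertex (false, i)).trans (Linked.inner rfl)
    · exact Linked.inner rfl
  refine isOptimal_of_le _ rfl (le_antisymm (orbits_le_one fun x y => (hc x).trans (hc y).symm)
    (orbits_pos _ _)) ?_
  -- Row `c` numbers the three edges of colour `c`; each with its copy in the other vertex bounds
  -- one loop.
  let I : Fin 3 → Fin 6 → Fin 3 := ![![0, 1, 1, 2, 2, 0], ![0, 0, 1, 1, 2, 2], ![0, 1, 2, 0, 1, 2]]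
  have h1 : ∀ c, Function.Surjective (I c) := by unfold Function.Surjective; decide
  have h3 : ∀ c i, I c (wheel c i) = I c i := by decide
  have h4 : ∀ c, 3 ≤ loops elementaryMelon.contr c := fun c =>
    le_orbits (fun x : elementaryMelon.V × Fin 6 => I c x.2)
      (fun j => (h1 c j).imp' (fun i => (true, i)) fun _ h => h) (fun x => rfl) (by
        rintro x y rfl
        exact h3 c x.2)
  have h5 : elementaryMelon.numVertices = 2 :=
    (Nat.card_eq_fintype_card (α := Bool)).trans Fintype.card_bool
  have := Finset.sum_le_sum fun c (_ : c ∈ Finset.univ) => h4 c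
  rw [h5]
  simpa using this

theorem IsElementary.isOptimal {E : TwoPoint} (hE : IsElementary E) : E.IsOptimal := by
  obtain ⟨g, hg, rfl | rfl⟩ := hE
  · exact isOptimal_recolour hg isOptimal_elementarySnail
  · exact isOptimal_recolour hg isOptimal_elementaryMelon

theorem IsMelonic.isOptimal {D : Diagram} (hD : D.IsMelonic) : D.IsOptimal := by
  induction hD with
  | ring =>
    have : IsEmpty Diagram.ring.V := inferInstanceAs (IsEmpty Empty)
    refine ⟨?_, ?_⟩
    · rw [numComponents_eq, comps, orbits_of_isEmpty]
      rfl
    · rw [numLoops_eq, numVertices, Nat.card_of_isEmpty]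
      simp only [loops, orbits_of_isEmpty]
      rfl
  | replaceRing D E hE _ hr ih => exact isOptimal_replaceRing D E ih hr (IsElementary.isOptimal hE)
  | replacePropagator D E hE _ h ih => exact isOptimal_join D _ h _ ih (IsElementary.isOptimal hE)
  | iso D D' _ h ih =>
    obtain ⟨e, g, h⟩ := h.exists_isoVia
    exact h.isOptimal ih

end Diagram

namespace Diagram

/-! ### Joins of melonic diagrams are melonic -/

theorem exchange_comm (D : Diagram) {h k h' k' : D.V × Fin 6} (h1 : h ≠ h') (h2 : h ≠ k')
    (h3 : k ≠ h') (h4 : k ≠ k') :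
    (D.exchange h k).exchange h' k' = (D.exchange h' k').exchange h k := by
  refine Diagram.mk_congr ?_
  change ((D.exchange h k).exchange h' k').contr = ((D.exchange h' k').exchange h k).contr
  refine (exchange_contr (D.exchange h k) h' k').trans
    (Eq.trans ?_ (exchange_contr (D.exchange h' k') h k).symm)
  rw [exchange_contr, exchange_contr]
  exact ex_comm D.contr h1 h2 h3 h4

theorem exchange_eq_exchange_contr (D : Diagram) (h k : D.V × Fin 6) :
    D.exchange h k = D.exchange (D.contr h) (D.contr k) := by
  refine Diagram.mk_congr ?_
  change (D.exchange h k).contr = (D.exchange (D.contr h) (D.contr k)).contr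
  rw [exchange_contr, exchange_contr]
  exact ex_eq_ex_contr D.isPairing h k

theorem exchange_swap (D : Diagram) (h k : D.V × Fin 6) : D.exchange h k = D.exchange k h := by
  refine Diagram.mk_congr ?_
  change (D.exchange h k).contr = (D.exchange k h).contr
  rw [exchange_contr, exchange_contr]
  funext x
  simp only [ex, Equiv.swap_comm]

theorem join_eq_join_contr (D E : Diagram) (h : D.V × Fin 6) (k : E.V × Fin 6) :
    D.join E h k = D.join E (D.contr h) (E.contr k) :=
  exchange_eq_exchange_contr (D.disjointUnion E) (inlField h) (inrField k)

theorem ex_apply_injective {X Y : Type*} {f : X → X} {f' : Y → Y} {φ : X → Y}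
    (hφ : Function.Injective φ) (h : ∀ x, f' (φ x) = φ (f x)) (a b x : X) :
    ex f' (φ a) (φ b) (φ x) = φ (ex f a b x) := by
  classical
  simp only [ex, hφ.swap_apply, h]

theorem IsoVia.exchange {D D' : Diagram} {e : D.V ≃ D'.V} {g : D.V → Equiv.Perm (Fin 6)}
    (I : IsoVia D D' e g) (h k : D.V × Fin 6) :
    IsoVia (D.exchange h k) (D'.exchange (fieldMap e g h) (fieldMap e g k)) e g where
  rings := I.rings
  aut := I.aut
  contr := by
    rw [exchange_contr, exchange_contr]
    exact ex_apply_injective (fieldMap e g).injective I.contr h k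

theorem isoVia_of_equiv {D D' : Diagram} (e : D.V ≃ D'.V) (hr : D.rings = D'.rings)
    (h : ∀ v i, D'.contr (e v, i) = (e (D.contr (v, i)).1, (D.contr (v, i)).2)) :
    IsoVia D D' e fun _ => 1 where
  rings := hr
  aut _ := isAutomorphism_one
  contr x := h x.1 x.2

theorem isoVia_disjointUnion {D D' E E' : Diagram} {e : D.V ≃ D'.V} {g : D.V → Equiv.Perm (Fin 6)}
    {e' : E.V ≃ E'.V} {g' : E.V → Equiv.Perm (Fin 6)} (I : IsoVia D D' e g) (J : IsoVia E E' e' g') :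
    IsoVia (D.disjointUnion E) (D'.disjointUnion E') (e.sumCongr e') (Sum.elim g g') where
  rings := congrArg₂ (· + ·) I.rings J.rings
  aut := by
    rintro (v | v)
    · exact I.aut v
    · exact J.aut v
  contr := by
    rintro ⟨v | v, i⟩
    · exact congrArg inlField (I.contr (v, i))
    · exact congrArg inrField (J.contr (v, i))

theorem isoVia_refl (D : Diagram) : IsoVia D D (Equiv.refl _) fun _ => 1 :=
  isoVia_of_equiv _ rfl fun _ _ => rfl

theorem isoVia_exchange_disjointUnion (D E : Diagram) (a b : D.V × Fin 6) :
    IsoVia ((D.exchange a b).disjointUnion E)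
      ((D.disjointUnion E).exchange (inlField a) (inlField b)) (Equiv.refl _) fun _ => 1 := by
  classical
  have key : ∀ x, ex (D.disjointUnion E).contr (inlField a) (inlField b) x =
      ((D.exchange a b).disjointUnion E).contr x := by
    rintro ⟨v | v, i⟩
    · change ex (D.disjointUnion E).contr _ _ (inlField (v, i)) =
        inlField ((D.exchange a b).contr (v, i))
      rw [exchange_contr]
      exact ex_apply_injective inlField_injective (disjointUnion_contr_inl D E) a b (v, i)
    · exact ex_apply_of_ne (D.disjointUnion E).isPairing (inlField_ne_inrField a (v, i)).symm
        (inlField_ne_inrField b (v, i)).symm (inlField_ne_inrField (D.contr a) (v, i)).symm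
        (inlField_ne_inrField (D.contr b) (v, i)).symm
  exact ⟨rfl, fun _ => isAutomorphism_one, fun x =>
    (congrFun (exchange_contr (D.disjointUnion E) (inlField a) (inlField b)) x).trans (key x)⟩

theorem isoVia_disjointUnion_exchange (D E : Diagram) (a b : E.V × Fin 6) :
    IsoVia ((D.disjointUnion E).exchange (inrField a) (inrField b))
      (D.disjointUnion (E.exchange a b)) (Equiv.refl _) fun _ => 1 := by
  classical
  have key : ∀ x, ex (D.disjointUnion E).contr (inrField a) (inrField b) x =
      (D.disjointUnion (E.exchange a b)).contr x := by
    rintro ⟨v | v, i⟩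
    · exact ex_apply_of_ne (D.disjointUnion E).isPairing (inlField_ne_inrField (v, i) a)
        (inlField_ne_inrField (v, i) b) (inlField_ne_inrField (v, i) (E.contr a))
        (inlField_ne_inrField (v, i) (E.contr b))
    · change ex (D.disjointUnion E).contr _ _ (inrField (v, i)) =
        inrField ((E.exchange a b).contr (v, i))
      rw [exchange_contr]
      exact ex_apply_injective inrField_injective (disjointUnion_contr_inr D E) a b (v, i)
  exact ⟨rfl, fun _ => isAutomorphism_one, fun x =>
    (key x).symm.trans (congrFun (exchange_contr (D.disjointUnion E) (inrField a)
      (inrField b)) x).symm⟩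

theorem isoVia_assoc (C D E : Diagram) :
    IsoVia ((C.disjointUnion D).disjointUnion E) (C.disjointUnion (D.disjointUnion E))
      (Equiv.sumAssoc C.V D.V E.V) fun _ => 1 :=
  isoVia_of_equiv _ (Nat.add_assoc _ _ _) (by rintro ((v | v) | v) i <;> rfl)

/-- The commutation of the last two summands of a sum of types. -/
def sumRightComm (α β γ : Type*) : (α ⊕ γ) ⊕ β ≃ α ⊕ (β ⊕ γ) :=
  (Equiv.sumAssoc α γ β).trans ((Equiv.refl α).sumCongr (Equiv.sumComm γ β))

theorem isoVia_rightComm (C D E : Diagram) :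
    IsoVia ((C.disjointUnion E).disjointUnion D) (C.disjointUnion (D.disjointUnion E))
      (sumRightComm C.V D.V E.V) fun _ => 1 :=
  isoVia_of_equiv _ (show C.rings + E.rings + D.rings = C.rings + (D.rings + E.rings) by omega)
    (by rintro ((v | v) | v) i <;> rfl)

theorem isMelonic_join_of_isElementary {D : Diagram} {E : TwoPoint} (hD : D.IsMelonic)
    (hE : IsElementary E) (h : D.V × Fin 6) (k : E.V × Fin 6) :
    (D.join E.toDiagram h k).IsMelonic := by
  rcases hE.withCut k with hE' | hE'
  · exact .replacePropagator D _ hE' hD h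
  · rw [join_eq_join_contr]
    exact .replacePropagator D _ hE' hD (D.contr h)

/-- Exchanges at distinct fields commute, so `C` can be joined first to whichever of `D` and `E`
carries `k`, and the other part attached afterwards. -/
theorem isMelonic_join_join {D : Diagram} {E : TwoPoint} (hE : IsElementary E)
    (hD : ∀ (C : Diagram) (h : C.V × Fin 6) (k : D.V × Fin 6), C.IsMelonic → (C.join D h k).IsMelonic)
    {C : Diagram} (hC : C.IsMelonic) (h : C.V × Fin 6) (a : D.V × Fin 6) (b : E.V × Fin 6)
    (k : (D.disjointUnion E.toDiagram).V × Fin 6) (hka : k ≠ inlField a) (hkb : k ≠ inrField b) :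
    (C.join (D.join E.toDiagram a b) h k).IsMelonic := by
  have I₀ := (isoVia_disjointUnion_exchange C (D.disjointUnion E.toDiagram) (inlField a)
    (inrField b)).exchange (inlField h) (inrField k)
  refine I₀.isMelonic ?_
  refine (congrArg IsMelonic (exchange_comm (C.disjointUnion (D.disjointUnion E.toDiagram))
    (h := inrField (inlField a)) (k := inrField (inrField b)) (h' := inlField h) (k' := inrField k)
    (inlField_ne_inrField _ _).symm (fun e => hka (inrField_injective e).symm)
    (inlField_ne_inrField _ _).symm (fun e => hkb (inrField_injective e).symm))).mpr ?_
  obtain ⟨v | v, i⟩ := k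
  · have I₁ := (isoVia_assoc C D E.toDiagram).exchange (inlField (inlField h))
      (inlField (inrField (v, i)))
    have I₂ := I₁.exchange (inlField (inrField a)) (inrField b)
    have I₃ := (isoVia_exchange_disjointUnion (C.disjointUnion D) E.toDiagram (inlField h)
      (inrField (v, i))).exchange (inlField (inrField a)) (inrField b)
    exact I₂.isMelonic (I₃.isMelonic
      (isMelonic_join_of_isElementary (hD C h (v, i) hC) hE (inrField a) b))
  · have I₁ := (isoVia_rightComm C D E.toDiagram).exchange (inlField (inlField h))
      (inlField (inrField (v, i)))
    have I₂ := I₁.exchange (inrField a) (inlField (inrField b))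
    have I₃ := (isoVia_exchange_disjointUnion (C.disjointUnion E.toDiagram) D (inlField h)
      (inrField (v, i))).exchange (inrField a) (inlField (inrField b))
    have J : ((C.join E.toDiagram h (v, i)).join D (@inrField C.V E.V b) a).IsMelonic :=
      hD _ _ _ (isMelonic_join_of_isElementary hC hE h (v, i))
    exact I₂.isMelonic (I₃.isMelonic ((congrArg IsMelonic (exchange_swap _ _ _)).mp J))

theorem isMelonic_join {C D : Diagram} (hC : C.IsMelonic) (hD : D.IsMelonic) (h : C.V × Fin 6)
    (k : D.V × Fin 6) : (C.join D h k).IsMelonic := by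
  induction hD generalizing C with
  | ring => exact k.1.elim
  | replaceRing D E hE hD hr _ =>
    obtain ⟨h1, h2⟩ := isEmpty_of_rings_pos hD.isOptimal.1 hr
    obtain ⟨v | v, i⟩ := k
    · exact isEmptyElim v
    have I : IsoVia E.toDiagram (D.replaceRing E) (Equiv.emptySum D.V E.V).symm fun _ => 1 :=
      isoVia_of_equiv _ (show E.rings = D.rings - 1 + E.rings by omega) fun v i => rfl
    exact ((isoVia_disjointUnion (isoVia_refl C) I).exchange (inlField h)
      (inrField (v, i))).isMelonic (isMelonic_join_of_isElementary hC hE h (v, i))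
  | replacePropagator D E hE hD a ih =>
    have key := fun a b hka hkb => isMelonic_join_join hE (fun C h k hC => ih hC h k) hC h a b k
      hka hkb
    -- If `k` is one of the exchanged fields, the same insertion is described by the opposite ends
    -- of the two propagators, which avoid `k`.
    by_cases hk : k ≠ inlField a ∧ k ≠ inrField E.cut
    · exact key a E.cut hk.1 hk.2
    · have I : IsoVia (D.join E.toDiagram (D.contr a) (E.contr E.cut)) (D.replacePropagator a E)
          (Equiv.refl _) fun _ => 1 :=
        ⟨rfl, fun _ => isAutomorphism_one, fun x => congrFun ((join_contr D E.toDiagram a E.cut).trans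
          ((ex_eq_ex_contr (D.disjointUnion E.toDiagram).isPairing _ _).trans
            (join_contr D E.toDiagram (D.contr a) (E.contr E.cut)).symm)) x⟩
      have J := key (D.contr a) (E.contr E.cut) (fun h1 => hk ⟨?_, ?_⟩) fun h1 => hk ⟨?_, ?_⟩
      · exact ((isoVia_disjointUnion (isoVia_refl C) I).exchange (inlField h)
          (inrField k)).isMelonic J
      · rw [h1]
        exact fun e => D.contr_ne a (inlField_injective e)
      · rw [h1]
        exact inlField_ne_inrField _ _
      · rw [h1]
        exact (inlField_ne_inrField _ _).symm
      · rw [h1]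
        exact fun e => E.contr_ne E.cut (inrField_injective e)
  | iso D D' hD hDD' ih =>
    obtain ⟨e, g, I⟩ := hDD'.exists_isoVia
    have J := (isoVia_disjointUnion (isoVia_refl C) I).exchange (inlField h)
      (inrField ((fieldMap e g).symm k))
    have hk : fieldMap e g ((fieldMap e g).symm k) = k := Equiv.apply_symm_apply _ _
    have : (C.join D' h (fieldMap e g ((fieldMap e g).symm k))).IsMelonic :=
      J.isMelonic (ih hC h ((fieldMap e g).symm k))
    rwa [hk] at this

end Diagram

/-! ### Decomposition of optimal diagrams. -/

namespace Diagram

theorem isMelonic_of_isElementary {E : TwoPoint} (hE : IsElementary E) :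
    E.toDiagram.IsMelonic := by
  have I : IsoVia (Diagram.ring.replaceRing E) E.toDiagram (Equiv.emptySum Empty E.V)
      fun _ => 1 := by
    refine isoVia_of_equiv _ (Nat.zero_add _) ?_
    rintro (v | v) i
    · exact v.elim
    · rfl
  exact I.isMelonic (.replaceRing _ E hE .ring Nat.one_pos)

theorem isElementary_elementarySnail : IsElementary elementarySnail :=
  ⟨1, isAutomorphism_one.isColourPermutation, Or.inl rfl⟩

theorem isElementary_elementaryMelon : IsElementary elementaryMelon :=
  ⟨1, isAutomorphism_one.isColourPermutation, Or.inr rfl⟩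

/-- There are melonic diagrams with any number of vertices. -/
theorem exists_isMelonic (n : ℕ) : ∃ D : Diagram, D.IsMelonic ∧ D.numVertices = n := by
  induction n with
  | zero => exact ⟨Diagram.ring, .ring, Nat.card_of_isEmpty (α := Empty)⟩
  | succ n ih =>
    obtain ⟨D, hD, hn⟩ := ih
    have h1 : elementarySnail.numVertices = 1 := Nat.card_unique (α := Unit)
    rcases isEmpty_or_nonempty D.V with h | ⟨⟨v⟩⟩
    · refine ⟨elementarySnail.toDiagram, isMelonic_of_isElementary isElementary_elementarySnail, ?_⟩
      rw [h1, ← hn, numVertices, Nat.card_of_isEmpty]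
    · refine ⟨D.replacePropagator (v, 0) elementarySnail,
        .replacePropagator D _ isElementary_elementarySnail hD _, ?_⟩
      rw [replacePropagator_eq, numVertices_join, h1, hn]

/-- The general bound is attained by a melonic diagram for each number of vertices, so the maximum
is the bound. -/
theorem isMaximal_iff_isOptimal (D : Diagram) : D.IsMaximal ↔ D.IsOptimal := by
  constructor
  · rintro ⟨h1, h2⟩
    refine ⟨h1, le_antisymm ?_ ?_⟩
    · have := D.numLoops_le
      rwa [h1] at this
    · obtain ⟨D', h3, h4⟩ := exists_isMelonic D.numVertices
      obtain ⟨h5, h6⟩ := h3.isOptimal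
      rw [← h4, ← h6]
      exact h2 D' h5 h4
  · rintro ⟨h1, h2⟩
    refine ⟨h1, fun D' h3 h4 => ?_⟩
    have := D'.numLoops_le
    rw [h3] at this
    omega

/-- The part of a diagram on a set of vertices which is closed under contraction. -/
def restrict (D : Diagram) (S : D.V → Prop) (hS : ∀ x, S x.1 → S (D.contr x).1) : Diagram where
  V := {v // S v}
  finite := inferInstance
  contr x := (⟨(D.contr (x.1.1, x.2)).1, hS _ x.1.2⟩, (D.contr (x.1.1, x.2)).2)
  contr_contr x := by
    have h := Prod.ext_iff.mp (D.contr_contr (x.1.1, x.2))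
    exact Prod.ext (Subtype.ext h.1) h.2
  contr_ne x hx := by
    have h := Prod.ext_iff.mp hx
    exact D.contr_ne (x.1.1, x.2) (Prod.ext (congrArg Subtype.val h.1) h.2)
  rings := 0

open Classical in
theorem isoVia_restrict (D : Diagram) (hr : D.rings = 0) (S : D.V → Prop)
    (hS : ∀ x, S x.1 → S (D.contr x).1) (hS' : ∀ x, ¬ S x.1 → ¬ S (D.contr x).1) :
    IsoVia ((D.restrict S hS).disjointUnion (D.restrict (fun v => ¬ S v) hS')) D
      (Equiv.sumCompl S) fun _ => 1 :=
  isoVia_of_equiv _ hr.symm (by rintro (v | v) i <;> rfl)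

theorem one_le_numComponents (D : Diagram) (v : D.V) : 1 ≤ D.numComponents := by
  have : Nonempty (D.V × Fin 6) := ⟨(v, 0)⟩
  have := orbits_pos D.contr SameVertex
  rw [numComponents_eq, comps]
  omega

/-- A diagram which an exchange disconnects is the join of two diagrams. -/
theorem exists_join (D : Diagram) (hr : D.rings = 0) (hc : comps D.contr = 1) (h k : D.V × Fin 6)
    (hex : 1 < comps (ex D.contr h k)) :
    ∃ (D₁ D₂ : Diagram) (h' : D₁.V × Fin 6) (k' : D₂.V × Fin 6)
      (e : (D₁.join D₂ h' k').V ≃ D.V), IsoVia (D₁.join D₂ h' k') D e fun _ => 1 := by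
  classical
  set D' := D.exchange h k with hD'
  have hcontr : D'.contr = ex D.contr h k := exchange_contr D h k
  have hl : ¬ Linked D'.contr SameVertex h k := fun hl => by
    rw [hcontr] at hl
    have : comps (ex D.contr h k) ≤ comps D.contr := orbits_ex_le_of_linked_ex hl
    omega
  have hS : ∀ x : D'.V × Fin 6, Linked D'.contr SameVertex h (x.1, 0) ↔
      Linked D'.contr SameVertex h ((D'.contr x).1, 0) := fun x => by
    have h1 : Linked D'.contr SameVertex (x.1, 0) x := Linked.inner rfl
    have h2 : Linked D'.contr SameVertex (D'.contr x) ((D'.contr x).1, 0) := Linked.inner rfl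
    exact linked_iff_of_linked ((h1.trans (Linked.contr D'.contr _ x)).trans h2)
  -- The exchanged diagram splits into the component of `h` and the remainder, which contains `k`;
  -- repeating the exchange restores `D` as their join.
  have I := isoVia_restrict D' hr (fun v => Linked D'.contr SameVertex h (v, 0))
    (fun x => (hS x).mp) (fun x => mt (hS x).mpr)
  have J := I.exchange (inlField (⟨h.1, Linked.inner rfl⟩, h.2))
    (inrField (⟨k.1, fun hk => hl (hk.trans (Linked.inner rfl))⟩, k.2))
  refine ⟨_, _, _, _, Equiv.sumCompl _, J.rings, J.aut, fun x => ?_⟩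
  refine Eq.trans ?_ (J.contr x)
  exact congrFun ((exchange_contr D' h k).trans
    ((congrArg (fun f => ex f h k) hcontr).trans (ex_ex D.contr h k))).symm _

theorem wheel_cases {c : Fin 3} (i j : Fin 6) : j = i ∨ j = wheel c i ∨
    ∃ r, c ≠ r ∧ (j = wheel r i ∨ j = wheel r (wheel c i)) := by
  revert c i j; decide

theorem forall_of_closed {D : Diagram} (hc : comps D.contr = 1) (S : D.V → Prop)
    (hS : ∀ x, S x.1 → S (D.contr x).1) {v : D.V} (hv : S v) (w : D.V) : S w := by
  refine (EqvGen.mem_iff (S := fun x : D.V × Fin 6 => S x.1) ?_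
    (linked_of_orbits_le_one hc.le (v, 0) (w, 0))).mp hv
  rintro x y (rfl | h)
  · refine ⟨hS x, fun h => ?_⟩
    have := hS _ h
    rwa [D.contr_contr] at this
  · exact (congrArg S h).to_iff

/-- A connected diagram with a loop of length one which no exchange disconnects is a snail. -/
theorem isMelonic_of_snail {D : Diagram} (hr : D.rings = 0) (hD : IsTight D.contr) {c : Fin 3}
    {h : D.V × Fin 6} (hh : D.contr h = edge c h) : D.IsMelonic := by
  obtain ⟨v, i⟩ := h
  have h1 : D.contr (v, wheel c i) = (v, i) := (D.isPairing.eq_comm).mp hh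
  have h2 : ∀ r, c ≠ r → D.contr (v, wheel r (wheel c i)) = (v, wheel r i) :=
    fun r hcr => hD.snail hcr hh
  have h3 : ∀ r, c ≠ r → D.contr (v, wheel r i) = (v, wheel r (wheel c i)) :=
    fun r hcr => (D.isPairing.eq_comm).mp (h2 r hcr)
  -- The three propagators of the closed snail are parallel to one edge of each colour, so it has a
  -- loop of length one in every colour and needs no recolouring.
  have hs : ∀ c, ∃ s, snailPairing s = wheel c s ∧ snailPairing (wheel c s) = s ∧
      ∀ r, c ≠ r → snailPairing (wheel r s) = wheel r (wheel c s) ∧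
        snailPairing (wheel r (wheel c s)) = wheel r s := by
    decide
  obtain ⟨s, hs1, hs2, hs3⟩ := hs c
  obtain ⟨g, hg, rfl⟩ := exists_automorphism s i
  have key : ∀ j, D.contr (v, g j) = (v, g (snailPairing j)) := by
    intro j
    rcases wheel_cases (c := c) s j with rfl | rfl | ⟨r, hcr, rfl | rfl⟩
    · rw [hs1, ← hg]
      exact hh
    · rw [hs2, ← hg]
      exact h1
    · rw [(hs3 r hcr).1, ← hg, ← hg, ← hg]
      exact h3 r hcr
    · rw [(hs3 r hcr).2, ← hg, ← hg, ← hg]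
      exact h2 r hcr
  have hv : ∀ w, w = v := forall_of_closed hD.comps_eq (fun w => w = v) (by
    rintro ⟨w, j⟩ rfl
    have := key (g.symm j)
    rw [Equiv.apply_symm_apply] at this
    rw [this]) rfl
  have I : IsoVia elementarySnail.toDiagram D
      ⟨fun _ => v, fun _ => (), fun _ => rfl, fun w => (hv w).symm⟩ fun _ => g :=
    ⟨hr.symm, fun _ => hg, fun x => key x.2⟩
  exact I.isMelonic (isMelonic_of_isElementary isElementary_elementarySnail)

/-- A connected diagram with a loop of length two, but none of length one, which no exchange
disconnects is a melon. -/
theorem isMelonic_of_melon {D : Diagram} (hr : D.rings = 0) (hD : IsTight D.contr)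
    (hshort : ∀ c h, D.contr h ≠ edge c h) {c : Fin 3} {h : D.V × Fin 6}
    (hh : D.contr (edge c h) = edge c (D.contr h)) : D.IsMelonic := by
  obtain ⟨hne, hmelon⟩ := hD.melon hshort hh
  obtain ⟨v, i⟩ := h
  obtain ⟨w, i', hw⟩ : ∃ w i', D.contr (v, i) = (w, i') := ⟨_, _, rfl⟩
  rw [hw] at hne hmelon hh
  obtain ⟨g, hg, rfl⟩ := exists_automorphism i i'
  have key : ∀ j, D.contr (v, j) = (w, g j) := by
    intro j
    rcases wheel_cases (c := c) i j with rfl | rfl | ⟨r, hcr, rfl | rfl⟩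
    · exact hw
    · rw [← hg]
      exact hh
    · rw [← hg]
      exact (hmelon r hcr).1
    · rw [← hg, ← hg]
      exact (hmelon r hcr).2
  have key' : ∀ j, D.contr (w, g j) = (v, j) := fun j => (D.isPairing.eq_comm).mp (key j)
  have hv : ∀ u, u = v ∨ u = w := forall_of_closed hD.comps_eq (fun u => u = v ∨ u = w) (by
    rintro ⟨u, j⟩ (rfl | rfl)
    · rw [key]
      exact Or.inr rfl
    · have := key' (g.symm j)
      rw [Equiv.apply_symm_apply] at this
      rw [this]
      exact Or.inl rfl) (Or.inl rfl)
  have hbij : Function.Bijective (fun b : Bool => cond b w v) := by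
    refine ⟨?_, fun u => ?_⟩
    · rintro (_ | _) (_ | _) e
      · rfl
      · exact (hne e).elim
      · exact (hne e.symm).elim
      · rfl
    · rcases hv u with rfl | rfl
      · exact ⟨false, rfl⟩
      · exact ⟨true, rfl⟩
  -- The fields of the second vertex are relabelled by the automorphism `g` that describes the
  -- contraction.
  have I : IsoVia elementaryMelon.toDiagram D (Equiv.ofBijective _ hbij)
      fun b => cond b g 1 := by
    refine ⟨hr.symm, ?_, ?_⟩
    · rintro (_ | _)
      · exact isAutomorphism_one
      · exact hg
    · rintro ⟨_ | _, j⟩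
      · exact key j
      · exact key' j
  exact I.isMelonic (isMelonic_of_isElementary isElementary_elementaryMelon)

theorem IsOptimal.isMelonic {D : Diagram} (hD : D.IsOptimal) : D.IsMelonic := by
  generalize hn : D.numVertices = n
  induction n using Nat.strong_induction_on generalizing D with
  | _ n ih =>
  have h1 := hD.1
  have h2 := hD.2
  rcases isEmpty_or_nonempty D.V with hV | ⟨⟨v⟩⟩
  · have h3 : D.rings = 1 := by
      rwa [numComponents_eq, comps, orbits_of_isEmpty, add_zero] at h1
    have I : IsoVia Diagram.ring D (Equiv.equivOfIsEmpty Empty D.V) fun _ => 1 :=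
      isoVia_of_equiv _ h3.symm fun v => v.elim
    exact I.isMelonic .ring
  have : Nonempty (D.V × Fin 6) := ⟨(v, 0)⟩
  have hpos : 0 < comps D.contr := orbits_pos D.contr SameVertex
  have hr : D.rings = 0 := by
    rw [numComponents_eq] at h1
    omega
  have hc : comps D.contr = 1 := by
    rw [numComponents_eq] at h1
    omega
  by_cases hex : ∃ h k, 1 < comps (ex D.contr h k)
  · obtain ⟨h, k, hex⟩ := hex
    obtain ⟨D₁, D₂, h', k', e, I⟩ := exists_join D hr hc h k hex
    have h3 := numComponents_join D₁ D₂ h' k'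
    have h4 := numLoops_join D₁ D₂ h' k'
    have h5 := numVertices_join D₁ D₂ h' k'
    have h6 := D₁.one_le_numComponents h'.1
    have h7 := D₂.one_le_numComponents k'.1
    have h8 := D₁.numLoops_le
    have h9 := D₂.numLoops_le
    have hp : 0 < D₁.numVertices := Nat.card_pos_iff.mpr ⟨⟨h'.1⟩, D₁.finite⟩
    have hp' : 0 < D₂.numVertices := Nat.card_pos_iff.mpr ⟨⟨k'.1⟩, D₂.finite⟩
    have e1 : (D₁.join D₂ h' k').numVertices = D.numVertices := Nat.card_congr e
    have e2 : (D₁.join D₂ h' k').numComponents = D.numComponents := by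
      rw [numComponents_eq, numComponents_eq, I.comps, I.rings]
    have e3 : (D₁.join D₂ h' k').numLoops = D.numLoops := by
      rw [numLoops_eq, numLoops_eq, I.rings]
      simp only [I.loops]
    -- The component numbers add up to 2, so each is 1; the two bounds add up to the attained total
    -- plus 3, so both are attained.
    have o1 : D₁.IsOptimal := ⟨by omega, by omega⟩
    have o2 : D₂.IsOptimal := ⟨by omega, by omega⟩
    exact I.isMelonic (isMelonic_join (ih _ (by omega) o1 rfl) (ih _ (by omega) o2 rfl) h' k')
  · push Not at hex
    have hT : IsTight D.contr :=
      { pairing := D.isPairing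
        comps_eq := hc
        sum_eq := by
          rw [numLoops_eq, numVertices] at h2
          omega
        comps_ex := hex }
    by_cases hshort : ∃ c h, D.contr h = edge c h
    · obtain ⟨c, h, hh⟩ := hshort
      exact isMelonic_of_snail hr hT hh
    · rcases hT.exists_short with hs | ⟨c, h, hh⟩
      · exact (hshort hs).elim
      · push Not at hshort
        exact isMelonic_of_melon hr hT hshort hh

end Diagram

end WheelModel

theorem mainTheorem5 (D : WheelModel.Diagram) : D.IsMaximal ↔ D.IsMelonic :=
  D.isMaximal_iff_isOptimal.trans
    ⟨WheelModel.Diagram.IsOptimal.isMelonic, WheelModel.Diagram.IsMelonic.isOptimal⟩
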